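/- **Setting.** A *probabilistic visibly pushdown automaton* (pVPA, without labels) $\Delta=(Q,q_0,\Gamma,\bot,P)$ consists of a finite set of states $Q=Q_{\mathsf{call}}\uplus Q_{\mathsf{int}}\uplus Q_{\mathsf{ret}}$, an initial state $q_0\in Q$, a finite stack alphabet $\Gamma\ni\bot$ with $\Gamma_{-\bot}=\Gamma\setminus\{\bot\}$, and probability distributions $P_{\mathsf{call}}(q,\cdot)$ on $Q\times\Gamma_{-\bot}$ for $q\in Q_{\mathsf{call}}$, $P_{\mathsf{int}}(q,\cdot)$ on $Q$ for $q\in Q_{\mathsf{int}}$, and $P_{\mathsf{ret}}(qZ,\cdot)$ on $Q$ for $q\in Q_{\mathsf{ret}}$, $Z\in\Gamma$. Configurations are the elements $q\gamma$ of $Q\times\Gamma_{-\bot}^*\bot$. The pVPA generates a Markov chain on configurations: for $q\in Q_{\mathsf{call}}$, $q\gamma$ moves to $rZ\gamma$ with probability $P_{\mathsf{call}}(q,rZ)$; for $q\in Q_{\mathsf{int}}$, $q\gamma$ moves to $r\gamma$ with probability $P_{\mathsf{int}}(q,r)$; for $q\in Q_{\mathsf{ret}}$, $qZ\gamma$ with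 $Z\neq\bot$ moves to $r\gamma$ with probability $P_{\mathsf{ret}}(qZ,r)$, and $q\bot$ moves to $r\bot$ with probability $P_{\mathsf{ret}}(q\bot,r)$. A *run* is an infinite sequence of configurations. Let $\mathbb P_c$ be the probability measure of this chain started in configuration $c$, on the $\sigma$-algebra generated by the cylinder sets of runs, and let $\mathbb P_\Delta=\mathbb P_{q_0\bot}$. (For every Markov chain, the probability measure on runs is defined in this way.) A position $i$ of a run is a *step* if the stack height at every position $n\ge i$ is at least the stack height at $i$; every run has infinitely many steps. Let $Q\bot=\{q\bot\mid q\in Q\}$. For a run $\rho$ and $n\ge 0$ let $V_n(\rho)\in Q\cup Q\bot$ be $q$ if the $n$-th step of $\rho$ (counted from $0$) has configuration $q\gamma$ with $\gamma\ne\bot$, and $q\bot$ if it has configuration $q\bot$. The *footprint* of $\rho$ is $V_0(\rho)V_1(\rho)V_2(\rho)\cdots$. For $q,r\in Q$ and $Z\in\Gamma_{-\bot}$, the *return probability* $[qZ{\downarrow}r]$ is the $\mathbb P_{qZ\bot}$-probability that $r\bot$ is eventually reached and that all configurations before that are not of the form $t\bot$. The *diverge probability* is $[q{\uparrow}]=1-\sum_{t\in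 Q}[qZ{\downarrow}t]$ (put $[q{\uparrow}]=0$ if $\Gamma_{-\bot}=\emptyset$). For $v,v'\in Q\cup Q\bot$ let $T(v,v')$ be given by the following table, where $q,r,r'$ range over $Q$ and $Z$ over $\Gamma_{-\bot}$. | | $q\to r$ | $q\bot\to r$ | $q\bot\to r\bot$ | $q\to r\bot$ | |---|---|---|---|---| | $q\in Q_{\mathsf{call}}$ | $\frac{[r\uparrow]}{[q\uparrow]}\bigl(\sum_{r',Z}P_{\mathsf{call}}(q,r'Z)[r'Z{\downarrow}r]+\sum_Z P_{\mathsf{call}}(q,rZ)\bigr)$ | $\sum_Z P_{\mathsf{call}}(q,rZ)[r{\uparrow}]$ | $\sum_{r',Z}P_{\mathsf{call}}(q,r'Z)[r'Z{\downarrow}r]$ | $0$ | | $q\in Q_{\mathsf{int}}$ | $\frac{[r\uparrow]}{[q\uparrow]}P_{\mathsf{int}}(q,r)$ | $0$ | $P_{\mathsf{int}}(q,r)$ | $0$ | | $q\in Q_{\mathsf{ret}}$ | undefined | $0$ | $P_{\mathsf{ret}}(q\bot,r)$ | undefined | **Lemma.** Let $\Delta$ be a pVPA. 1. The diverge probability $[q{\uparrow}]$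 does not depend on the choice of $Z\in\Gamma_{-\bot}$, and each $V_n$ is measurable. 2. For all $n\ge 0$ and $v,v'\in Q\cup Q\bot$ with $\mathbb P_\Delta(V_n=v)>0$, we have $\mathbb P_\Delta(V_{n+1}=v'\mid V_n=v)=T(v,v')$. The undefined entries of the table do not occur here: $\mathbb P_\Delta(V_n=q)=0$ for all $n\ge0$ and $q\in Q_{\mathsf{ret}}$. 3. Let $M=\{q\in Q_{\mathsf{call}}\cup Q_{\mathsf{int}}\mid[q{\uparrow}]>0\}\cup Q\bot$. Then $\sum_{v'\in M}T(v,v')=1$ for all $v\in M$, so that $M$ with initial state $q_0\bot$ and transition probabilities $T$ is a finite Markov chain, the *step chain* $\mathcal M_\Delta$. Moreover, for every measurable $R\subseteq M^\omega$, the set of runs of $\Delta$ whose footprint lies in $R$ is measurable, and $$\mathbb P_\Delta(\{\rho\mid \text{the footprint of }\rho\text{ lies in }R\})=\mathbb P_{\mathcal M_\Delta}(R).$$ -/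

import Mathlib

open MeasureTheory ProbabilityTheory Finset
open scoped ENNReal

noncomputable section

/-! ### Discrete-time Markov chains and their probability measure on runs -/

/-- A discrete-time Markov chain on the state space `S`: an initial state and, for every state, a
probability distribution over successor states. -/
structure MarkovChain (S : Type*) where
  /-- the initial state -/
  init : S
  /-- the transition probabilities -/
  P : S → PMF S

namespace MarkovChain

variable {S : Type*} [MeasurableSpace S] [DiscreteMeasurableSpace S]

/-- The transition function as a kernel which, given the states visited up to time `n`, returns the
law of the state at time `n + 1`; it only looks at the state at time `n`. -/
def stepKernel (C : MarkovChain S) (n : ℕ) : Kernel (∀ _ : Iic n, S) S where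
  toFun := fun x => (C.P (x ⟨n, mem_Iic.2 le_rfl⟩)).toMeasure
  measurable' := (Measurable.of_discrete (f := fun s : S => (C.P s).toMeasure)).comp
    (measurable_pi_apply _)

instance (C : MarkovChain S) (n : ℕ) : IsMarkovKernel (C.stepKernel n) :=
  ⟨fun _ => inferInstanceAs (IsProbabilityMeasure (PMF.toMeasure _))⟩

/-- The probability measure of the Markov chain on its runs `ℕ → S` (with the product σ-algebra,
which is generated by the cylinder sets when `S` is countable). See `measure_cylinder`
for its values on cylinder sets. -/
def measure (C : MarkovChain S) : Measure (ℕ → S) :=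
  Kernel.traj (X := fun _ => S) C.stepKernel 0 (fun _ => C.init)

instance (C : MarkovChain S) : IsProbabilityMeasure C.measure := by
  unfold measure; infer_instance

/-- The run measure gives the cylinder set of the finite word `w 0, …, w n` the product of the
transition probabilities along it if the word starts in the initial state, and `0` otherwise. -/
theorem measure_cylinder (C : MarkovChain S) (w : ℕ → S) (n : ℕ) [Decidable (w 0 = C.init)] :
    C.measure {ρ | ∀ i ≤ n, ρ i = w i} =
      if w 0 = C.init then ∏ i ∈ range n, C.P (w i) (w (i + 1)) else 0 := by
  have key : ∀ n, Kernel.partialTraj (X := fun _ => S) C.stepKernel 0 n (fun _ => C.init)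
      {fun i : Iic n => w i} = if w 0 = C.init then ∏ i ∈ range n, C.P (w i) (w (i + 1)) else 0 := by
    intro n
    induction n with
    | zero =>
      rw [Kernel.partialTraj_self, Kernel.id_apply, Measure.dirac_apply' _ (measurableSet_singleton _)]
      by_cases h : w 0 = C.init
      · rw [if_pos h, Set.indicator_of_mem]
        · simp
        · ext i
          obtain ⟨i, hi⟩ := i
          obtain rfl : i = 0 := by simpa using hi
          exact h.symm
      · rw [if_neg h, Set.indicator_of_notMem]
        intro h'
        exact h (congrFun h' ⟨0, by simp⟩).symm
    | succ n ih =>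
      rw [Kernel.partialTraj_succ_of_le (Nat.zero_le n), Kernel.map_apply' _
        (measurable_IicProdIoc (X := fun _ => S)) _ (measurableSet_singleton _)]
      have hpre : (IicProdIoc (X := fun _ => S) n (n + 1)) ⁻¹' {fun i : Iic (n + 1) => w i} =
          {fun i : Iic n => w i} ×ˢ
            {fun i : Ioc n (n + 1) => w i} := by
        ext ⟨x, y⟩
        simp only [Set.mem_preimage, Set.mem_singleton_iff, Set.mem_prod]
        constructor
        · intro h
          refine ⟨?_, ?_⟩
          · ext ⟨i, hi⟩
            have hi' : i ≤ n := mem_Iic.1 hi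
            have := congrFun h ⟨i, mem_Iic.2 (by omega)⟩
            simpa [IicProdIoc, hi'] using this
          · ext ⟨i, hi⟩
            have hi' := mem_Ioc.1 hi
            have := congrFun h ⟨i, mem_Iic.2 (by omega)⟩
            simpa [IicProdIoc, show ¬ i ≤ n by omega] using this
        · rintro ⟨rfl, rfl⟩
          ext ⟨i, hi⟩
          simp [IicProdIoc]
      rw [hpre, Kernel.comp_apply' _ _ _ ((measurableSet_singleton _).prod (measurableSet_singleton _))]
      have hint : ∀ x : (∀ _ : Iic n, S),
          (Kernel.id ×ₖ ((C.stepKernel n).map (MeasurableEquiv.piSingleton (X := fun _ => S) n))) x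
            ({fun i : Iic n => w i} ×ˢ
              {fun i : Ioc n (n + 1) => w i}) =
          ({fun i : Iic n => w i} : Set (∀ _ : Iic n, S)).indicator
            (fun _ => C.P (w n) (w (n + 1))) x := by
        intro x
        have := Kernel.IsMarkovKernel.map (C.stepKernel n)
          (MeasurableEquiv.piSingleton (X := fun _ => S) n).measurable
        rw [Kernel.prod_apply, Measure.prod_prod, Kernel.id_apply,
          Measure.dirac_apply' _ (measurableSet_singleton _),
          Kernel.map_apply' _ (MeasurableEquiv.measurable _) _ (measurableSet_singleton _)]
        by_cases hx : x = fun i : Iic n => w i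
        · subst hx
          have hs : (MeasurableEquiv.piSingleton (X := fun _ => S) n) ⁻¹'
              {fun i : Ioc n (n + 1) => w i} = {w (n + 1)} := by
            ext s
            rw [Set.mem_preimage, Set.mem_singleton_iff, Set.mem_singleton_iff,
              ← MeasurableEquiv.eq_symm_apply]
            rfl
          rw [hs]
          simp [stepKernel, PMF.toMeasure_apply_singleton]
        · simp [hx]
      rw [lintegral_congr hint, lintegral_indicator_const (measurableSet_singleton _), ih,
        prod_range_succ]
      split_ifs <;> simp [mul_comm]
  have hcyl : {ρ : ℕ → S | ∀ i ≤ n, ρ i = w i} =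
      Preorder.frestrictLe (π := fun _ => S) n ⁻¹'
        {fun i : Iic n => w i} := by
    ext ρ
    simp [funext_iff, Preorder.frestrictLe, Finset.restrict]
  rw [hcyl, ← Measure.map_apply (by fun_prop) (measurableSet_singleton _), measure,
    Kernel.traj_map_frestrictLe_apply, key]

end MarkovChain

/-! ### Probabilistic visibly pushdown automata -/

/-- The three types of states. -/
inductive StackOp
  | call
  | int
  | ret

/-- A probabilistic visibly pushdown automaton (without labels) with states `Q`. The type `Γ`
consists of the stack symbols other than the bottom symbol, so that the stack alphabet is
`WithBot Γ`, with `⊥` as the bottom-of-stack symbol. -/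
structure PVPA (Q Γ : Type*) where
  /-- the initial state -/
  init : Q
  /-- the partition of the states into call, internal and return states -/
  kind : Q → StackOp
  /-- a call state draws a successor state and a symbol to push -/
  Pcall : ∀ q, kind q = .call → PMF (Q × Γ)
  /-- an internal state draws a successor state -/
  Pint : ∀ q, kind q = .int → PMF Q
  /-- a return state draws a successor state depending on the topmost stack symbol -/
  Pret : ∀ q, kind q = .ret → WithBot Γ → PMF Q

/-- A configuration: a state and a stack content, topmost symbol first. The bottom symbol is
implicit: the list `γ` stands for the stack `γ⊥`. -/
structure Config (Q Γ : Type*) where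
  /-- the current state -/
  state : Q
  /-- the stack content above the bottom symbol -/
  stack : List Γ

instance {Q Γ : Type*} : MeasurableSpace (Config Q Γ) := ⊤

instance {Q Γ : Type*} : DiscreteMeasurableSpace (Config Q Γ) := ⟨fun _ => trivial⟩

/-- The extended states: `plain q` is the state `q`, and `bottom q` is the extended state `q⊥`. -/
inductive ExtState (Q : Type*)
  | plain (q : Q)
  | bottom (q : Q)

instance {Q : Type*} : MeasurableSpace (ExtState Q) := ⊤

instance {Q : Type*} : DiscreteMeasurableSpace (ExtState Q) := ⟨fun _ => trivial⟩

instance {Q : Type*} (s : Set (ExtState Q)) : DiscreteMeasurableSpace s :=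
  ⟨fun t => ⟨(↑) '' t, trivial, Set.preimage_image_eq t Subtype.val_injective⟩⟩

/-! ### Steps of runs -/

section Steps

variable {Q Γ : Type*}

/-- Position `i` of the run `ρ` is a step if the stack height (the number of symbols above the
bottom symbol) never falls below its value at `i` from then on. -/
def IsStep (ρ : ℕ → Config Q Γ) (i : ℕ) : Prop :=
  ∀ n ≥ i, (ρ i).stack.length ≤ (ρ n).stack.length

/-- Every sequence of configurations has infinitely many steps, so that the `n`-th step below is
always meaningful. -/
theorem infinite_isStep (ρ : ℕ → Config Q Γ) : {i | IsStep ρ i}.Infinite := by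
  refine Set.infinite_of_not_bddAbove ?_
  rintro ⟨N, hN⟩
  obtain ⟨i, hi, hmin⟩ := WellFounded.has_min
    (InvImage.wf (fun i => (ρ i).stack.length) Nat.lt_wfRel.wf) (Set.Ici (N + 1)) ⟨N + 1, Set.mem_Ici.2 le_rfl⟩
  have hstep : IsStep ρ i := fun n hn => not_lt.1 (hmin n (le_trans hi hn))
  have h1 : i ≤ N := hN hstep
  have h2 : N + 1 ≤ i := hi
  omega

/-- The extended state of a configuration: it remembers the state and whether the stack
consists of the bottom symbol only. -/
def Config.toExt : Config Q Γ → ExtState Q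
  | ⟨q, []⟩ => .bottom q
  | ⟨q, _ :: _⟩ => .plain q

/-- The extended state at the `n`-th step of the run `ρ` (counting from `0`). -/
def stepVar (n : ℕ) (ρ : ℕ → Config Q Γ) : ExtState Q :=
  (ρ (Nat.nth (IsStep ρ) n)).toExt

/-- The step footprint of a run. -/
def footprint (ρ : ℕ → Config Q Γ) : ℕ → ExtState Q := fun n => stepVar n ρ

end Steps

namespace PVPA

variable {Q Γ : Type*}

/-- The distribution of the successor of a configuration: a call state pushes, an internal state
leaves the stack unchanged, and a return state pops the topmost symbol, except that the bottom
symbol is read but never removed. -/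
def next (Δ : PVPA Q Γ) (c : Config Q Γ) : PMF (Config Q Γ) :=
  match h : Δ.kind c.state with
  | .call => (Δ.Pcall c.state h).map fun x => ⟨x.1, x.2 :: c.stack⟩
  | .int => (Δ.Pint c.state h).map fun r => ⟨r, c.stack⟩
  | .ret =>
    match c.stack with
    | [] => (Δ.Pret c.state h ⊥).map fun r => ⟨r, []⟩
    | Z :: γ => (Δ.Pret c.state h Z).map fun r => ⟨r, γ⟩

/-- The (infinite) Markov chain on configurations generated by the automaton, started in `c`. -/
def chainFrom (Δ : PVPA Q Γ) (c : Config Q Γ) : MarkovChain (Config Q Γ) := ⟨c, Δ.next⟩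

/-- The probability measure on runs of the automaton, started in its initial state with empty
stack. -/
def prob (Δ : PVPA Q Γ) : Measure (ℕ → Config Q Γ) := (Δ.chainFrom ⟨Δ.init, []⟩).measure

/-- The return probability `[qZ↓r]`: starting in the configuration `qZ⊥`, the configuration `r⊥` is
eventually reached, and all configurations before that are non-bottom configurations. -/
def ret (Δ : PVPA Q Γ) (q : Q) (Z : Γ) (r : Q) : ℝ≥0∞ :=
  (Δ.chainFrom ⟨q, [Z]⟩).measure
    {ρ | ∃ k, ρ k = ⟨r, []⟩ ∧ ∀ j < k, (ρ j).stack ≠ []}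

variable [Fintype Q]

/-- The diverge probability `[q↑] = 1 - ∑ t, [qZ↓t]`. The right-hand side does not depend on the
symbol `Z`; the supremum picks the common value. If there is no symbol besides the bottom
symbol, then the value is irrelevant and set to `0`. -/
def diverge (Δ : PVPA Q Γ) (q : Q) : ℝ≥0∞ :=
  ⨆ Z : Γ, (1 - ∑ t, Δ.ret q Z t)

/-- The states of the step chain: the call and internal states with positive diverge
probability, and all the extended states `q⊥`. -/
def stepStates (Δ : PVPA Q Γ) : Set (ExtState Q) :=
  {v | (∃ q, v = .plain q ∧ (Δ.kind q = .call ∨ Δ.kind q = .int) ∧ 0 < Δ.diverge q) ∨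
    ∃ q, v = .bottom q}

variable [Fintype Γ]

/-- The table of next-step probabilities `v → v'`. The entries that start in a non-bottom return
state are undefined in the table and have the dummy value `0` here. -/
def nextStep (Δ : PVPA Q Γ) : ExtState Q → ExtState Q → ℝ≥0∞
  | .plain q, .plain r =>
    match h : Δ.kind q with
    | .call => Δ.diverge r / Δ.diverge q *
        (∑ r', ∑ Z, Δ.Pcall q h (r', Z) * Δ.ret r' Z r + ∑ Z, Δ.Pcall q h (r, Z))
    | .int => Δ.diverge r / Δ.diverge q * Δ.Pint q h r
    | .ret => 0
  | .bottom q, .plain r =>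
    match h : Δ.kind q with
    | .call => ∑ Z, Δ.Pcall q h (r, Z) * Δ.diverge r
    | .int => 0
    | .ret => 0
  | .bottom q, .bottom r =>
    match h : Δ.kind q with
    | .call => ∑ r', ∑ Z, Δ.Pcall q h (r', Z) * Δ.ret r' Z r
    | .int => Δ.Pint q h r
    | .ret => Δ.Pret q h ⊥ r
  | .plain _, .bottom _ => 0

/-- The step chain: the Markov chain on `stepStates` with initial state `q₀⊥` and the transition
probabilities of the table. Its second argument says that the rows of the table sum to one. -/
def stepChain (Δ : PVPA Q Γ)
    (h : ∀ v : Δ.stepStates, ∑' v' : Δ.stepStates, Δ.nextStep v v' = 1) :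
    MarkovChain Δ.stepStates where
  init := ⟨.bottom Δ.init, .inr ⟨Δ.init, rfl⟩⟩
  P v := ⟨fun v' => Δ.nextStep v v', (h v) ▸ ENNReal.summable.hasSum⟩

end PVPA

end

/-! Whether a position is a step depends on the entire future of the run, so the Markov property of
the footprint is not immediate. Instead of conditioning on this event, the proof computes joint laws
restricted to it. From a configuration `c`, position `0` is a step with a probability that depends
only on the extended state of `c`: it is `1` for the empty stack, and `[q↑]` otherwise (`stayProb`,
`law_isStep`).

The core is `law_stepVar_cylinder`: if `c` has extended state `w 0`, then the probability that `0`
is a step and `V_i = w i` for all `i ≤ n` is `stayProb (w 0)` times the product of the table entries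
along `w`. The induction on `n` splits off the first transition. After an internal move, or a return
move on the empty stack, the next position is the next step. After a call, either the pushed symbol
is never popped and the next position is the next step, or the run comes back to the old stack in
some state `r` and the next step is there. The strong Markov property `law_hit` gives the second
case a return probability as factor. The quotients `[r↑]/[q↑]` in the table cancel against the
factor `stayProb` (`stayProb_mul_nextStep_call`, `stayProb_mul_nextStep_int`).

From the initial configuration, position `0` is almost surely a step, so cylinder probabilities of
the footprint are products of table entries. The conditional probabilities follow by summing over
prefixes. The equality with the step chain follows because cylinders determine the measure
(`ext_of_cylinder`). Rows sum to one by the same first-transition analysis, applied to the event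
that `0` is a step (`diverge_call`, `diverge_int`), and by `diverge_add_sum_ret` for call states on
the empty stack. -/

noncomputable section

/-! ### Generalities on Markov chains -/

/-- Prepend a state to a run. -/
def consRun {S : Type*} (s : S) (ρ : ℕ → S) : ℕ → S
  | 0 => s
  | n + 1 => ρ n

/-- Drop the first `k` states of a run. -/
def shiftRun {S : Type*} (k : ℕ) (ρ : ℕ → S) : ℕ → S := fun n => ρ (n + k)

@[simp] theorem consRun_zero {S : Type*} (s : S) (ρ : ℕ → S) : consRun s ρ 0 = s := rfl

@[simp] theorem consRun_succ {S : Type*} (s : S) (ρ : ℕ → S) (n : ℕ) :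
    consRun s ρ (n + 1) = ρ n := rfl

@[simp] theorem shiftRun_apply {S : Type*} (k : ℕ) (ρ : ℕ → S) (n : ℕ) :
    shiftRun k ρ n = ρ (n + k) := rfl

theorem shiftRun_succ_consRun {S : Type*} (s : S) (k : ℕ) (ρ : ℕ → S) :
    shiftRun (k + 1) (consRun s ρ) = shiftRun k ρ := rfl

theorem shiftRun_zero {S : Type*} (ρ : ℕ → S) : shiftRun 0 ρ = ρ := rfl

theorem measurable_consRun {S : Type*} [MeasurableSpace S] (s : S) :
    Measurable (consRun s) := by
  refine measurable_pi_iff.2 fun n => ?_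
  cases n with
  | zero => exact measurable_const
  | succ n => exact measurable_pi_apply n

theorem measurable_shiftRun {S : Type*} [MeasurableSpace S] (k : ℕ) :
    Measurable (shiftRun (S := S) k) :=
  measurable_pi_iff.2 fun n => measurable_pi_apply (n + k)

theorem measurableSet_cylinder {S : Type*} [MeasurableSpace S] [DiscreteMeasurableSpace S]
    (w : ℕ → S) (n : ℕ) : MeasurableSet {ρ : ℕ → S | ∀ i ≤ n, ρ i = w i} := by
  have : {ρ : ℕ → S | ∀ i ≤ n, ρ i = w i} = ⋂ i, ⋂ (_ : i ≤ n), (fun ρ : ℕ → S => ρ i) ⁻¹' {w i} := by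
    ext; simp
  rw [this]
  exact MeasurableSet.iInter fun i => MeasurableSet.iInter fun _ =>
    measurable_pi_apply i (measurableSet_singleton _)

/-- A finite measure on runs over a countable state space is determined by its values on cylinder
sets. -/
theorem ext_of_cylinder {S : Type*} [MeasurableSpace S] [DiscreteMeasurableSpace S] [Countable S]
    {μ ν : Measure (ℕ → S)} [IsFiniteMeasure ν]
    (h : ∀ (w : ℕ → S) n, μ {ρ | ∀ i ≤ n, ρ i = w i} = ν {ρ | ∀ i ≤ n, ρ i = w i}) : μ = ν := by
  have key : ∀ n, μ.map (Preorder.frestrictLe (π := fun _ : ℕ => S) n) =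
      ν.map (Preorder.frestrictLe n) := by
    intro n
    refine Measure.ext_of_singleton fun a => ?_
    rw [Measure.map_apply (by fun_prop) (measurableSet_singleton _),
      Measure.map_apply (by fun_prop) (measurableSet_singleton _)]
    -- The finite word is extended to an infinite one by repeating its last letter; the cylinder
    -- does not see the extension.
    have : Preorder.frestrictLe (π := fun _ : ℕ => S) n ⁻¹' {a} =
        {ρ | ∀ i ≤ n, ρ i = if hi : i ≤ n then a ⟨i, mem_Iic.2 hi⟩ else a ⟨n, by simp⟩} := by
      ext ρ
      simp only [Set.mem_preimage, Set.mem_singleton_iff, Set.mem_ofPred_eq, funext_iff]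
      constructor
      · intro h i hi
        rw [dif_pos hi, ← h]; rfl
      · rintro h ⟨i, hi⟩
        have := h i (mem_Iic.1 hi)
        rw [dif_pos (mem_Iic.1 hi)] at this
        exact this
    rw [this, h]
  have hlim : IsProjectiveLimit μ (fun I => ν.map I.restrict) := by
    intro I
    have hI : I ⊆ Iic (I.sup id) := I.subset_Iic_sup_id
    have h1 := congrArg (fun m => Measure.map (restrict₂ (π := fun _ : ℕ => S) hI) m) (key (I.sup id))
    simp only at h1
    rw [Measure.map_map (by fun_prop) (by fun_prop),
      Measure.map_map (by fun_prop) (by fun_prop)] at h1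
    exact h1
  exact hlim.unique fun I => rfl

/-- Sums against the image of a distribution. -/
theorem PMF.tsum_map_mul {α β : Type*} (p : PMF α) (f : α → β) (g : β → ℝ≥0∞) :
    ∑' b, p.map f b * g b = ∑' a, p a * g (f a) := by
  classical
  simp only [PMF.map_apply, ← ENNReal.tsum_mul_right]
  rw [ENNReal.tsum_comm]
  refine tsum_congr fun a => ?_
  rw [tsum_eq_single (f a)]
  · simp
  · intro b hb
    simp [hb]

namespace MarkovChain

variable {S : Type*} [MeasurableSpace S] [DiscreteMeasurableSpace S]

/-- The law of the runs with transition probabilities `P` started in `s`. -/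
def law (P : S → PMF S) (s : S) : Measure (ℕ → S) := MarkovChain.measure ⟨s, P⟩

instance (P : S → PMF S) (s : S) : IsProbabilityMeasure (law P s) := by
  unfold law; infer_instance

theorem law_cylinder (P : S → PMF S) (s : S) (w : ℕ → S) (n : ℕ) [Decidable (w 0 = s)] :
    law P s {ρ | ∀ i ≤ n, ρ i = w i} =
      if w 0 = s then ∏ i ∈ range n, P (w i) (w (i + 1)) else 0 :=
  measure_cylinder ⟨s, P⟩ w n

theorem ae_zero_eq (P : S → PMF S) (s : S) : ∀ᵐ ρ ∂law P s, ρ 0 = s := by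
  classical
  have h := law_cylinder P s (fun _ => s) 0
  simp only [Nat.le_zero, forall_eq, range_zero, prod_empty, if_true] at h
  have hm : MeasurableSet {ρ : ℕ → S | ρ 0 = s} :=
    (measurable_pi_apply 0 : Measurable fun ρ : ℕ → S => ρ 0) (measurableSet_singleton s)
  exact (mem_ae_iff_prob_eq_one hm).2 h

variable [Countable S]

/-- One-step analysis: the law of a run conditioned on its first transition. -/
theorem law_eq_sum (P : S → PMF S) (s : S) :
    law P s = Measure.sum fun t => P s t • (law P t).map (consRun s) := by
  classical
  -- `ext_of_cylinder` wants finiteness only of its right-hand measure, which is evident for `law`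
  -- but not for the sum.
  symm
  refine ext_of_cylinder fun w n => ?_
  rw [law_cylinder, Measure.sum_apply _ (measurableSet_cylinder w n)]
  simp only [Measure.smul_apply, smul_eq_mul,
    Measure.map_apply (measurable_consRun s) (measurableSet_cylinder w n)]
  by_cases h : w 0 = s
  · rw [if_pos h]
    cases n with
    | zero =>
      have : consRun s ⁻¹' {ρ | ∀ i ≤ 0, ρ i = w i} = Set.univ := by
        ext ρ; simp [h]
      rw [this]
      simp [PMF.tsum_coe]
    | succ n =>
      have : consRun s ⁻¹' {ρ | ∀ i ≤ n + 1, ρ i = w i} = {ρ | ∀ i ≤ n, ρ i = w (i + 1)} := by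
        ext ρ
        simp only [Set.mem_preimage, Set.mem_ofPred_eq]
        constructor
        · intro hρ i hi
          exact hρ (i + 1) (by omega)
        · intro hρ i hi
          cases i with
          | zero => exact h.symm
          | succ i => exact hρ i (by omega)
      simp only [this, law_cylinder P _ (fun i => w (i + 1))]
      rw [tsum_eq_single (w 1), prod_range_succ', mul_comm]
      · simp [h]
      · intro t ht
        simp [ht.symm]
  · rw [if_neg h]
    have : consRun s ⁻¹' {ρ | ∀ i ≤ n, ρ i = w i} = ∅ := by
      ext ρ
      simp only [Set.mem_preimage, Set.mem_ofPred_eq, Set.mem_empty_iff_false, iff_false]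
      intro hρ
      exact h (hρ 0 (Nat.zero_le _)).symm
    simp [this]

theorem law_apply (P : S → PMF S) (s : S) {A : Set (ℕ → S)} (hA : MeasurableSet A) :
    law P s A = ∑' t, P s t * law P t (consRun s ⁻¹' A) := by
  conv_lhs => rw [law_eq_sum]
  rw [Measure.sum_apply _ hA]
  simp only [Measure.smul_apply, smul_eq_mul, Measure.map_apply (measurable_consRun s) hA]

/-- Almost surely, a run only uses transitions of positive probability. -/
theorem ae_valid (P : S → PMF S) (s : S) : ∀ᵐ ρ ∂law P s, ∀ n, P (ρ n) (ρ (n + 1)) ≠ 0 := by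
  rw [ae_all_iff]
  intro n
  have hm : ∀ n, MeasurableSet {ρ : ℕ → S | P (ρ n) (ρ (n + 1)) = 0} := fun n =>
    ((measurable_pi_apply n).prodMk (measurable_pi_apply (n + 1)) :
      Measurable fun ρ : ℕ → S => (ρ n, ρ (n + 1)))
      (MeasurableSet.of_discrete (s := {x : S × S | P x.1 x.2 = 0}))
  induction n generalizing s with
  | zero =>
    simp only [ae_iff, not_not]
    rw [law_apply _ _ (hm 0), ENNReal.tsum_eq_zero]
    intro t
    by_cases ht : P s t = 0
    · simp [ht]
    · rw [mul_eq_zero]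
      right
      refine measure_mono_null ?_ (ae_iff.1 (ae_zero_eq P t))
      intro ρ hρ h0
      simp only [Set.mem_preimage, Set.mem_ofPred_eq, consRun_zero, consRun_succ, h0] at hρ
      exact ht hρ
  | succ n ih =>
    simp only [ae_iff, not_not] at ih ⊢
    rw [law_apply _ _ (hm _), ENNReal.tsum_eq_zero]
    intro t
    rw [mul_eq_zero]
    exact Or.inr (ih t)

end MarkovChain

/-! ### Runs of pushdown automata -/

instance {Q Γ : Type*} [Countable Q] [Countable Γ] : Countable (Config Q Γ) :=
  Function.Injective.countable (f := fun c : Config Q Γ => (c.state, c.stack)) fun a b h => by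
    cases a; cases b; simpa using h

/-- The runs that reach the configuration `⟨r, γ⟩` at time `k`, and whose stack is strictly higher
before. -/
def hitAt {Q Γ : Type*} (γ : List Γ) (r : Q) (k : ℕ) : Set (ℕ → Config Q Γ) :=
  {ρ | ρ k = ⟨r, γ⟩ ∧ ∀ j < k, γ.length < (ρ j).stack.length}

theorem measurableSet_stack {Q Γ : Type*} (p : List Γ → Prop) (j : ℕ) :
    MeasurableSet {ρ : ℕ → Config Q Γ | p (ρ j).stack} :=
  (measurable_pi_apply j : Measurable fun ρ : ℕ → Config Q Γ => ρ j) (MeasurableSet.of_discrete (s := {c : Config Q Γ | p c.stack}))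

theorem measurableSet_hitAt {Q Γ : Type*} (γ : List Γ) (r : Q) (k : ℕ) :
    MeasurableSet (hitAt γ r k) := by
  have : hitAt γ r k = (fun ρ : ℕ → Config Q Γ => ρ k) ⁻¹' {⟨r, γ⟩} ∩
      ⋂ j, ⋂ (_ : j < k), {ρ | γ.length < (ρ j).stack.length} := by
    ext; simp [hitAt]
  rw [this]
  exact (measurable_pi_apply k (measurableSet_singleton _)).inter
    (MeasurableSet.iInter fun j => MeasurableSet.iInter fun _ =>
      measurableSet_stack (fun δ => γ.length < δ.length) j)

/-- Only the first time at the level of `γ` can qualify, and the run fixes the state there. Hence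
the hitting events are disjoint in both `r` and `k`, and their probabilities add up. -/
theorem hitAt_disjoint {Q Γ : Type*} {γ : List Γ} {r r' : Q} {k k' : ℕ} {ρ : ℕ → Config Q Γ}
    (h : ρ ∈ hitAt γ r k) (h' : ρ ∈ hitAt γ r' k') : k = k' ∧ r = r' := by
  have hk : k = k' := by
    rcases lt_trichotomy k k' with hlt | rfl | hlt
    · have := h'.2 k hlt
      rw [h.1] at this
      exact absurd this (lt_irrefl _)
    · rfl
    · have := h.2 k' hlt
      rw [h'.1] at this
      exact absurd this (lt_irrefl _)
  subst hk
  have := h.1.symm.trans h'.1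
  exact ⟨rfl, congrArg Config.state this⟩

namespace PVPA

open MarkovChain

variable {Q Γ : Type*} (Δ : PVPA Q Γ)

theorem next_call {q : Q} (h : Δ.kind q = .call) (γ : List Γ) :
    Δ.next ⟨q, γ⟩ = (Δ.Pcall q h).map fun x => ⟨x.1, x.2 :: γ⟩ := by
  unfold next
  split <;> rename_i h' <;> first | rfl | exact absurd (h.symm.trans h') (by simp)

theorem next_int {q : Q} (h : Δ.kind q = .int) (γ : List Γ) :
    Δ.next ⟨q, γ⟩ = (Δ.Pint q h).map fun r => ⟨r, γ⟩ := by
  unfold next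
  split <;> rename_i h' <;> first | rfl | exact absurd (h.symm.trans h') (by simp)

theorem next_ret_nil {q : Q} (h : Δ.kind q = .ret) :
    Δ.next ⟨q, []⟩ = (Δ.Pret q h ⊥).map fun r => ⟨r, []⟩ := by
  unfold next
  split <;> rename_i h' <;> first | rfl | exact absurd (h.symm.trans h') (by simp)

theorem next_ret_cons {q : Q} (h : Δ.kind q = .ret) (Z : Γ) (γ : List Γ) :
    Δ.next ⟨q, Z :: γ⟩ = (Δ.Pret q h Z).map fun r => ⟨r, γ⟩ := by
  unfold next
  split <;> rename_i h' <;> first | rfl | exact absurd (h.symm.trans h') (by simp)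

/-- Transitions of a configuration with nonempty stack do not depend on the rest of the stack. -/
theorem next_append (q : Q) (Z : Γ) (δ γ : List Γ) :
    Δ.next ⟨q, Z :: δ ++ γ⟩ = (Δ.next ⟨q, Z :: δ⟩).map fun c => ⟨c.state, c.stack ++ γ⟩ := by
  cases h : Δ.kind q with
  | call => rw [next_call _ h, next_call _ h, PMF.map_comp]; rfl
  | int => rw [next_int _ h, next_int _ h, PMF.map_comp]; rfl
  | ret =>
    rw [List.cons_append, next_ret_cons _ h, next_ret_cons _ h, PMF.map_comp]; rfl

/-- The possible changes of the stack in one transition. -/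
theorem next_support {c c' : Config Q Γ} (h : Δ.next c c' ≠ 0) :
    (Δ.kind c.state = .call ∧ ∃ Z, c'.stack = Z :: c.stack) ∨
      (Δ.kind c.state = .int ∧ c'.stack = c.stack) ∨
      (Δ.kind c.state = .ret ∧ c'.stack = c.stack.tail) := by
  obtain ⟨q, γ⟩ := c
  rw [← PMF.mem_support_iff] at h
  cases hk : Δ.kind q with
  | call =>
    rw [next_call _ hk, PMF.mem_support_map_iff] at h
    obtain ⟨x, -, rfl⟩ := h
    simp
  | int =>
    rw [next_int _ hk, PMF.mem_support_map_iff] at h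
    obtain ⟨x, -, rfl⟩ := h
    simp
  | ret =>
    cases γ with
    | nil =>
      rw [next_ret_nil _ hk, PMF.mem_support_map_iff] at h
      obtain ⟨x, -, rfl⟩ := h
      simp
    | cons Z γ =>
      rw [next_ret_cons _ hk, PMF.mem_support_map_iff] at h
      obtain ⟨x, -, rfl⟩ := h
      simp

/-- As long as the stack is higher than `γ`, it stays on top of `γ`. -/
theorem exists_append_of_valid {ρ : ℕ → Config Q Γ} (hρ : ∀ n, Δ.next (ρ n) (ρ (n + 1)) ≠ 0)
    {δ γ : List Γ} (h0 : (ρ 0).stack = δ ++ γ) {k : ℕ}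
    (hk : ∀ j < k, γ.length < (ρ j).stack.length) : ∃ d, (ρ k).stack = d ++ γ := by
  induction k with
  | zero => exact ⟨δ, h0⟩
  | succ k ih =>
    obtain ⟨d, hd⟩ := ih fun j hj => hk j (by omega)
    have hlen := hk k (by omega)
    rcases Δ.next_support (hρ k) with ⟨-, Z, h⟩ | ⟨-, h⟩ | ⟨-, h⟩
    · exact ⟨Z :: d, by rw [h, hd]; rfl⟩
    · exact ⟨d, h.trans hd⟩
    · rw [hd] at hlen h
      cases d with
      | nil => simp at hlen
      | cons Y d => exact ⟨d, h⟩

/-- At the first time the height is at most that of `γ`, the stack still has the form `d ++ γ`, so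
`d` is empty: the level is reached with exactly `γ` on the stack. -/
theorem exists_hitAt_of_valid {ρ : ℕ → Config Q Γ} (hρ : ∀ n, Δ.next (ρ n) (ρ (n + 1)) ≠ 0)
    {δ γ : List Γ} (h0 : (ρ 0).stack = δ ++ γ) (h : ∃ k, (ρ k).stack.length ≤ γ.length) :
    ∃ r k, ρ ∈ hitAt γ r k := by
  classical
  have hmin : ∀ j < Nat.find h, γ.length < (ρ j).stack.length := fun j hj =>
    not_le.1 (Nat.find_min h hj)
  obtain ⟨d, hd⟩ := Δ.exists_append_of_valid hρ h0 hmin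
  have hle := Nat.find_spec h
  rw [hd, List.length_append] at hle
  have hd0 : d = [] := List.length_eq_zero_iff.1 (by omega)
  refine ⟨(ρ (Nat.find h)).state, Nat.find h, ?_, hmin⟩
  rw [hd0, List.nil_append] at hd
  exact congrArg (Config.mk (ρ (Nat.find h)).state) hd

theorem ret_eq_law (q : Q) (Z : Γ) (r : Q) :
    Δ.ret q Z r = law Δ.next ⟨q, [Z]⟩ {ρ | ∃ k, ρ ∈ hitAt [] r k} := by
  unfold ret hitAt law chainFrom
  congr! 7
  simp [List.length_pos_iff]

/-! ### Strong Markov property at the first return to a stack level -/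

variable [Countable Q] [Countable Γ]

/-- Until `γ` is uncovered, the run evolves as if `γ` were absent (`next_append`); afterwards it
restarts from `⟨r, γ⟩`. Fixing the hitting time `k` allows an induction on `k` via the first
transition. -/
theorem law_hitAt_append {A : Set (ℕ → Config Q Γ)} (hA : MeasurableSet A) (γ : List Γ) (r : Q)
    (k : ℕ) (q : Q) (δ : List Γ) :
    law Δ.next ⟨q, δ ++ γ⟩ {ρ | ρ ∈ hitAt γ r k ∧ shiftRun k ρ ∈ A} =
      law Δ.next ⟨q, δ⟩ (hitAt [] r k) * law Δ.next ⟨r, γ⟩ A := by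
  have hmeas : ∀ k, MeasurableSet {ρ : ℕ → Config Q Γ | ρ ∈ hitAt γ r k ∧ shiftRun k ρ ∈ A} :=
    fun k => (measurableSet_hitAt γ r k).inter (measurable_shiftRun k hA)
  induction k generalizing q δ with
  | zero =>
    by_cases h : q = r ∧ δ = []
    · obtain ⟨rfl, rfl⟩ := h
      have h1 : law Δ.next ⟨q, []⟩ (hitAt [] q 0) = 1 := by
        refine (mem_ae_iff_prob_eq_one (measurableSet_hitAt _ _ _)).1 ?_
        filter_upwards [ae_zero_eq Δ.next ⟨q, []⟩] with ρ hρ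
        exact ⟨hρ, by simp⟩
      rw [h1, one_mul]
      refine measure_congr ?_
      filter_upwards [ae_zero_eq Δ.next ⟨q, γ⟩] with ρ hρ
      refine propext ⟨fun h => h.2, fun h => ⟨⟨hρ, by simp⟩, h⟩⟩
    · have h1 : law Δ.next ⟨q, δ⟩ (hitAt [] r 0) = 0 := by
        refine measure_mono_null ?_ (ae_iff.1 (ae_zero_eq Δ.next ⟨q, δ⟩))
        intro ρ hρ h0
        have := h0.symm.trans hρ.1
        simp only [Config.mk.injEq] at this
        exact h this
      rw [h1, zero_mul]
      refine measure_mono_null ?_ (ae_iff.1 (ae_zero_eq Δ.next ⟨q, δ ++ γ⟩))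
      intro ρ hρ h0
      have := h0.symm.trans hρ.1.1
      simp only [Config.mk.injEq, List.append_left_eq_self] at this
      exact h this
  | succ k ih =>
    cases δ with
    | nil =>
      have h1 : law Δ.next ⟨q, []⟩ (hitAt [] r (k + 1)) = 0 := by
        refine measure_mono_null ?_ (ae_iff.1 (ae_zero_eq Δ.next ⟨q, []⟩))
        intro ρ hρ h0
        have := hρ.2 0 (by omega)
        rw [h0] at this
        exact lt_irrefl _ this
      rw [h1, zero_mul]
      refine measure_mono_null ?_ (ae_iff.1 (ae_zero_eq Δ.next ⟨q, [] ++ γ⟩))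
      intro ρ hρ h0
      have := hρ.1.2 0 (by omega)
      rw [h0] at this
      exact lt_irrefl _ this
    | cons Z δ =>
      have hcons : ∀ (β : List Γ) (c : Config Q Γ) (ρ : ℕ → Config Q Γ),
          β.length < c.stack.length →
          (consRun c ρ ∈ hitAt β r (k + 1) ↔ ρ ∈ hitAt β r k) := by
        intro β c ρ hc
        constructor
        · exact fun h => ⟨h.1, fun j hj => h.2 (j + 1) (by omega)⟩
        · refine fun h => ⟨h.1, fun j hj => ?_⟩
          cases j with
          | zero => exact hc
          | succ j => exact h.2 j (by omega)
      rw [law_apply _ _ (hmeas _), law_apply _ _ (measurableSet_hitAt _ _ _), next_append,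
        PMF.tsum_map_mul, ← ENNReal.tsum_mul_right]
      refine tsum_congr fun c => ?_
      rw [mul_assoc]
      congr 1
      rw [← show (⟨c.state, c.stack⟩ : Config Q Γ) = c from rfl]
      convert ih c.state c.stack using 2
      · ext ρ
        simp only [Set.mem_preimage, Set.mem_ofPred_eq, shiftRun_succ_consRun]
        rw [hcons γ _ _ (by simp)]
      · congr 1
        ext ρ
        simp only [Set.mem_preimage]
        rw [hcons [] _ _ (by simp)]

/-- Strong Markov property at the first time the topmost symbol is popped. -/
theorem law_hit {A : Set (ℕ → Config Q Γ)} (hA : MeasurableSet A) (γ : List Γ) (q : Q) (Z : Γ)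
    (r : Q) :
    law Δ.next ⟨q, Z :: γ⟩ {ρ | ∃ k, ρ ∈ hitAt γ r k ∧ shiftRun k ρ ∈ A} =
      Δ.ret q Z r * law Δ.next ⟨r, γ⟩ A := by
  have hU : ∀ (β : List Γ) {B : Set (ℕ → Config Q Γ)} (_ : MeasurableSet B)
      (c : Config Q Γ), law Δ.next c {ρ | ∃ k, ρ ∈ hitAt β r k ∧ shiftRun k ρ ∈ B} =
      ∑' k, law Δ.next c {ρ | ρ ∈ hitAt β r k ∧ shiftRun k ρ ∈ B} := by
    intro β B hB c
    rw [← measure_iUnion]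
    · congr 1
      ext ρ
      simp
    · intro k k' hne
      refine Set.disjoint_left.2 fun ρ h h' => hne (hitAt_disjoint h.1 h'.1).1
    · exact fun k => (measurableSet_hitAt β r k).inter (measurable_shiftRun k hB)
  rw [hU γ hA, ret_eq_law, ← ENNReal.tsum_mul_right.trans (congrArg (· * _) (?_ : _ =
    law Δ.next ⟨q, [Z]⟩ {ρ | ∃ k, ρ ∈ hitAt [] r k}))]
  · exact tsum_congr fun k => Δ.law_hitAt_append hA γ r k q [Z]
  · have := hU [] MeasurableSet.univ ⟨q, [Z]⟩
    simp only [Set.mem_univ, and_true] at this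
    exact this.symm

end PVPA

theorem measurableSet_isStep {Q Γ : Type*} (i : ℕ) :
    MeasurableSet {ρ : ℕ → Config Q Γ | IsStep ρ i} := by
  have hl : ∀ n, Measurable fun ρ : ℕ → Config Q Γ => (ρ n).stack.length := fun n =>
    (Measurable.of_discrete (f := fun c : Config Q Γ => c.stack.length)).comp
      (measurable_pi_apply n)
  have : {ρ : ℕ → Config Q Γ | IsStep ρ i} =
      ⋂ n, ⋂ (_ : n ≥ i), {ρ | (ρ i).stack.length ≤ (ρ n).stack.length} := by
    ext; simp [IsStep]
  rw [this]
  exact MeasurableSet.iInter fun n => MeasurableSet.iInter fun _ =>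
    measurableSet_le (hl i) (hl n)

theorem measurableSet_exists_hitAt {Q Γ : Type*} (γ : List Γ) (t : Q) :
    MeasurableSet {ρ : ℕ → Config Q Γ | ∃ k, ρ ∈ hitAt γ t k} := by
  have : {ρ : ℕ → Config Q Γ | ∃ k, ρ ∈ hitAt γ t k} = ⋃ k, hitAt γ t k := by ext; simp
  rw [this]
  exact MeasurableSet.iUnion fun k => measurableSet_hitAt γ t k

/-! ### Divergence as the probability that position `0` is a step -/

namespace PVPA

open MarkovChain

variable {Q Γ : Type*} (Δ : PVPA Q Γ)

/-- The law of the first steps with nonempty stack does not depend on the bottommost symbol. -/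
theorem law_stack_ne_nil_congr [Countable Q] [Countable Γ] (k : ℕ) (q : Q) (δ : List Γ)
    (Z Z' : Γ) :
    law Δ.next ⟨q, δ ++ [Z]⟩ {ρ | ∀ j ≤ k, (ρ j).stack ≠ []} =
      law Δ.next ⟨q, δ ++ [Z']⟩ {ρ | ∀ j ≤ k, (ρ j).stack ≠ []} := by
  have hmeas : ∀ k, MeasurableSet {ρ : ℕ → Config Q Γ | ∀ j ≤ k, (ρ j).stack ≠ []} := by
    intro k
    have : {ρ : ℕ → Config Q Γ | ∀ j ≤ k, (ρ j).stack ≠ []} =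
        ⋂ j, ⋂ (_ : j ≤ k), {ρ | (ρ j).stack ≠ []} := by
      ext; simp
    rw [this]
    exact MeasurableSet.iInter fun j => MeasurableSet.iInter fun _ =>
      measurableSet_stack (fun δ => δ ≠ []) j
  induction k generalizing q δ with
  | zero =>
    have h1 : ∀ Z, law Δ.next ⟨q, δ ++ [Z]⟩ {ρ | ∀ j ≤ 0, (ρ j).stack ≠ []} = 1 := by
      intro Z
      refine (mem_ae_iff_prob_eq_one (hmeas _)).1 ?_
      filter_upwards [ae_zero_eq Δ.next ⟨q, δ ++ [Z]⟩] with ρ hρ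
      intro j hj
      obtain rfl : j = 0 := by omega
      simp [hρ]
    rw [h1, h1]
  | succ k ih =>
    have hstep : ∀ Z, consRun (⟨q, δ ++ [Z]⟩ : Config Q Γ) ⁻¹'
        {ρ | ∀ j ≤ k + 1, (ρ j).stack ≠ []} = {ρ | ∀ j ≤ k, (ρ j).stack ≠ []} := by
      intro Z
      ext ρ
      constructor
      · exact fun h j hj => h (j + 1) (by omega)
      · intro h j hj
        cases j with
        | zero => simp
        | succ j => exact h j (by omega)
    rw [law_apply _ _ (hmeas _), law_apply _ _ (hmeas _), hstep, hstep]
    cases h : Δ.kind q with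
    | call =>
      rw [next_call _ h, next_call _ h, PMF.tsum_map_mul, PMF.tsum_map_mul]
      exact tsum_congr fun x => congrArg _ (ih x.1 (x.2 :: δ))
    | int =>
      rw [next_int _ h, next_int _ h, PMF.tsum_map_mul, PMF.tsum_map_mul]
      exact tsum_congr fun r => congrArg _ (ih r δ)
    | ret =>
      cases δ with
      | cons Y δ =>
        rw [List.cons_append, List.cons_append, next_ret_cons _ h, next_ret_cons _ h,
          PMF.tsum_map_mul, PMF.tsum_map_mul]
        exact tsum_congr fun r => congrArg _ (ih r δ)
      -- This is the only place where the bottommost symbol is read. It is popped at once, and the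
      -- event fails for either symbol.
      | nil =>
        have h0 : ∀ r : Q, law Δ.next ⟨r, []⟩ {ρ | ∀ j ≤ k, (ρ j).stack ≠ []} = 0 := by
          intro r
          refine measure_mono_null ?_ (ae_iff.1 (ae_zero_eq Δ.next ⟨r, []⟩))
          intro ρ hρ h0
          have := hρ 0 (by omega)
          rw [h0] at this
          exact this rfl
        rw [List.nil_append, List.nil_append, next_ret_cons _ h, next_ret_cons _ h,
          PMF.tsum_map_mul, PMF.tsum_map_mul]
        simp [h0]

/-- The event is the decreasing limit of its finite-horizon versions, for which the symbol is
irrelevant by `law_stack_ne_nil_congr`. -/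
theorem law_isStep_singleton [Countable Q] [Countable Γ] (q : Q) (Z Z' : Γ) :
    law Δ.next ⟨q, [Z]⟩ {ρ | IsStep ρ 0} = law Δ.next ⟨q, [Z']⟩ {ρ | IsStep ρ 0} := by
  have h1 : ∀ Z : Γ, law Δ.next ⟨q, [Z]⟩ {ρ | IsStep ρ 0} =
      ⨅ k, law Δ.next ⟨q, [Z]⟩ {ρ | ∀ j ≤ k, (ρ j).stack ≠ []} := by
    intro Z
    rw [← Antitone.measure_iInter]
    · refine measure_congr ?_
      filter_upwards [ae_zero_eq Δ.next ⟨q, [Z]⟩] with ρ hρ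
      refine propext ?_
      change IsStep ρ 0 ↔ ρ ∈ ⋂ k, {ρ : ℕ → Config Q Γ | ∀ j ≤ k, (ρ j).stack ≠ []}
      simp only [IsStep, hρ, Set.mem_iInter, Set.mem_ofPred_eq, List.length_singleton,
        Nat.one_le_iff_ne_zero, ne_eq, List.length_eq_zero_iff]
      exact ⟨fun h k j _ => h j (Nat.zero_le _), fun h n _ => h n n le_rfl⟩
    · intro k k' hk ρ h j hj
      exact h j (hj.trans hk)
    · intro k
      have : {ρ : ℕ → Config Q Γ | ∀ j ≤ k, (ρ j).stack ≠ []} =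
          ⋂ j, ⋂ (_ : j ≤ k), {ρ | (ρ j).stack ≠ []} := by
        ext; simp
      rw [this]
      exact (MeasurableSet.iInter fun j => MeasurableSet.iInter fun _ =>
        measurableSet_stack (fun δ => δ ≠ []) j).nullMeasurableSet
    · exact ⟨0, measure_ne_top _ _⟩
  rw [h1, h1]
  exact iInf_congr fun k => Δ.law_stack_ne_nil_congr k q [] Z Z'

theorem law_isStep_nil [Countable Q] [Countable Γ] (q : Q) :
    law Δ.next ⟨q, []⟩ {ρ | IsStep ρ 0} = 1 := by
  refine (mem_ae_iff_prob_eq_one (measurableSet_isStep 0)).1 ?_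
  filter_upwards [ae_zero_eq Δ.next ⟨q, []⟩] with ρ h0
  intro n _
  simp [h0]

variable [Fintype Q]

/-- The return probabilities add up to the probability that the topmost symbol is popped. -/
theorem sum_ret_eq_law [Countable Γ] (q : Q) (Z : Γ) (γ : List Γ) :
    ∑ t, Δ.ret q Z t = law Δ.next ⟨q, Z :: γ⟩ (⋃ t, {ρ | ∃ k, ρ ∈ hitAt γ t k}) := by
  have hret : ∀ t, Δ.ret q Z t = law Δ.next ⟨q, Z :: γ⟩ {ρ | ∃ k, ρ ∈ hitAt γ t k} := by
    intro t
    have := Δ.law_hit MeasurableSet.univ γ q Z t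
    simpa using this.symm
  rw [measure_iUnion _ (measurableSet_exists_hitAt γ), tsum_fintype]
  · exact sum_congr rfl fun t _ => hret t
  · intro t t' hne
    refine Set.disjoint_left.2 ?_
    rintro ρ ⟨k, h⟩ ⟨k', h'⟩
    exact hne (hitAt_disjoint h h').2

/-- Position `0` fails to be a step exactly when `Z` is eventually popped, up to the null set of
runs using impossible transitions. The right-hand side does not mention `γ`, so neither does the
probability depend on it. -/
theorem law_isStep_cons_eq_sub [Countable Γ] (q : Q) (Z : Γ) (γ : List Γ) :
    law Δ.next ⟨q, Z :: γ⟩ {ρ | IsStep ρ 0} = 1 - ∑ t, Δ.ret q Z t := by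
  rw [Δ.sum_ret_eq_law q Z γ, ← prob_compl_eq_one_sub (MeasurableSet.iUnion fun t =>
    measurableSet_exists_hitAt γ t)]
  refine measure_congr ?_
  filter_upwards [ae_zero_eq Δ.next ⟨q, Z :: γ⟩, ae_valid Δ.next ⟨q, Z :: γ⟩] with ρ h0 hv
  refine propext ?_
  change IsStep ρ 0 ↔ ρ ∈ (⋃ t, {ρ : ℕ → Config Q Γ | ∃ k, ρ ∈ hitAt γ t k})ᶜ
  simp only [Set.mem_compl_iff, Set.mem_iUnion, Set.mem_ofPred_eq, IsStep, h0]
  constructor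
  · rintro h ⟨t, k, hk⟩
    have := h k (Nat.zero_le _)
    rw [hk.1] at this
    simp at this
  · intro h n _
    by_contra hn
    have h0' : (ρ 0).stack = [Z] ++ γ := by rw [h0]; rfl
    refine h (Δ.exists_hitAt_of_valid hv h0' ⟨n, ?_⟩)
    simp only [List.length_cons, not_le] at hn
    omega

theorem one_sub_sum_ret_congr [Countable Γ] (q : Q) (Z Z' : Γ) :
    1 - ∑ t, Δ.ret q Z t = 1 - ∑ t, Δ.ret q Z' t := by
  rw [← Δ.law_isStep_cons_eq_sub q Z [], ← Δ.law_isStep_cons_eq_sub q Z' [],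
    Δ.law_isStep_singleton q Z Z']

theorem diverge_eq [Countable Γ] (q : Q) (Z : Γ) : Δ.diverge q = 1 - ∑ t, Δ.ret q Z t := by
  unfold diverge
  have : Nonempty Γ := ⟨Z⟩
  rw [iSup_congr fun Z' => Δ.one_sub_sum_ret_congr q Z' Z, iSup_const]

theorem law_isStep_cons [Countable Γ] (q : Q) (Z : Γ) (γ : List Γ) :
    law Δ.next ⟨q, Z :: γ⟩ {ρ | IsStep ρ 0} = Δ.diverge q := by
  rw [law_isStep_cons_eq_sub, diverge_eq _ q Z]

theorem sum_ret_le_one [Countable Γ] (q : Q) (Z : Γ) : ∑ t, Δ.ret q Z t ≤ 1 := by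
  rw [Δ.sum_ret_eq_law q Z []]
  exact prob_le_one

theorem diverge_add_sum_ret [Countable Γ] (q : Q) (Z : Γ) :
    Δ.diverge q + ∑ t, Δ.ret q Z t = 1 := by
  rw [diverge_eq _ q Z, tsub_add_cancel_of_le (Δ.sum_ret_le_one q Z)]

theorem diverge_le_one (q : Q) : Δ.diverge q ≤ 1 :=
  iSup_le fun _ => tsub_le_self

end PVPA

/-! ### The sequence of steps of a run -/

section StepSequence

variable {Q Γ : Type*}

/-- Expressing `Nat.nth` through `Nat.count` gives countably many measurable conditions and makes
step indices additive under shifts. -/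
theorem nth_isStep_eq_iff [∀ ρ : ℕ → Config Q Γ, DecidablePred (IsStep ρ)]
    (ρ : ℕ → Config Q Γ) (n k : ℕ) :
    Nat.nth (IsStep ρ) n = k ↔ IsStep ρ k ∧ Nat.count (IsStep ρ) k = n := by
  constructor
  · rintro rfl
    exact ⟨Nat.nth_mem_of_infinite (infinite_isStep ρ) n,
      Nat.count_nth_of_infinite (infinite_isStep ρ) n⟩
  · rintro ⟨h, rfl⟩
    exact Nat.nth_count h

theorem isStep_shiftRun_iff (ρ : ℕ → Config Q Γ) (k i : ℕ) :
    IsStep (shiftRun k ρ) i ↔ IsStep ρ (i + k) := by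
  constructor
  · intro h n hn
    have := h (n - k) (by omega)
    simpa [show n - k + k = n by omega] using this
  · exact fun h n hn => h (n + k) (by omega)

/-- The position of the first step after position `0`. -/
theorem nth_isStep_one_eq {ρ : ℕ → Config Q Γ} {k : ℕ} (h0 : IsStep ρ 0) (hk : IsStep ρ (k + 1))
    (hbetween : ∀ j < k, ¬ IsStep ρ (j + 1)) : Nat.nth (IsStep ρ) 1 = k + 1 := by
  classical
  rw [nth_isStep_eq_iff]
  refine ⟨hk, ?_⟩
  rw [Nat.count_succ', if_pos h0, Nat.count_iff_forall_not.2 hbetween]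

theorem measurable_nth_isStep (n : ℕ) :
    Measurable fun ρ : ℕ → Config Q Γ => Nat.nth (IsStep ρ) n := by
  classical
  have hcount : ∀ k, Measurable fun ρ : ℕ → Config Q Γ => Nat.count (IsStep ρ) k := by
    intro k
    induction k with
    | zero => simp
    | succ k ih =>
      simp only [Nat.count_succ]
      exact ih.add (Measurable.ite (measurableSet_isStep k) measurable_const measurable_const)
  refine measurable_to_countable' fun k => ?_
  have : (fun ρ : ℕ → Config Q Γ => Nat.nth (IsStep ρ) n) ⁻¹' {k} =
      {ρ | IsStep ρ k} ∩ (fun ρ => Nat.count (IsStep ρ) k) ⁻¹' {n} := by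
    ext ρ
    exact nth_isStep_eq_iff ρ n k
  rw [this]
  exact (measurableSet_isStep k).inter (hcount k (measurableSet_singleton n))

/-- The part of a run from its first step after position `0` on, provided that `0` is a step. -/
def nextStepRun (ρ : ℕ → Config Q Γ) : ℕ → Config Q Γ := shiftRun (Nat.nth (IsStep ρ) 1) ρ

theorem measurable_shiftRun_nth (n : ℕ) :
    Measurable fun ρ : ℕ → Config Q Γ => shiftRun (Nat.nth (IsStep ρ) n) ρ := by
  intro B hB
  have : (fun ρ : ℕ → Config Q Γ => shiftRun (Nat.nth (IsStep ρ) n) ρ) ⁻¹' B =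
      ⋃ k, (fun ρ : ℕ → Config Q Γ => Nat.nth (IsStep ρ) n) ⁻¹' {k} ∩ shiftRun k ⁻¹' B := by
    ext ρ
    simp
  rw [this]
  exact MeasurableSet.iUnion fun k =>
    (measurable_nth_isStep n (measurableSet_singleton k)).inter (measurable_shiftRun k hB)

theorem measurable_nextStepRun : Measurable (nextStepRun (Q := Q) (Γ := Γ)) :=
  measurable_shiftRun_nth 1

theorem measurable_stepVar (n : ℕ) : Measurable (stepVar (Q := Q) (Γ := Γ) n) := by
  have h : stepVar (Q := Q) (Γ := Γ) n =
      fun ρ => (shiftRun (Nat.nth (IsStep ρ) n) ρ 0).toExt := by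
    ext ρ
    simp [stepVar]
  rw [h]
  exact (Measurable.of_discrete (f := Config.toExt (Q := Q) (Γ := Γ))).comp
    ((measurable_pi_apply 0).comp (measurable_shiftRun_nth n))

theorem stepVar_zero {ρ : ℕ → Config Q Γ} (h : IsStep ρ 0) : stepVar 0 ρ = (ρ 0).toExt := by
  rw [stepVar, Nat.nth_zero_of_zero h]

/-- Being a step depends only on the future, so the steps of the shifted run are the steps of `ρ`
from step number `1` on. Exactly one step of `ρ` precedes the cut. -/
theorem stepVar_succ (ρ : ℕ → Config Q Γ) (i : ℕ) :
    stepVar (i + 1) ρ = stepVar i (nextStepRun ρ) := by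
  classical
  set k := Nat.nth (IsStep ρ) 1 with hk
  have hiff : ∀ j, IsStep (nextStepRun ρ) j ↔ IsStep ρ (k + j) := fun j => by
    rw [nextStepRun, isStep_shiftRun_iff, add_comm]
  have hnth : Nat.nth (IsStep ρ) (i + 1) = k + Nat.nth (IsStep (nextStepRun ρ)) i := by
    obtain ⟨h1, h2⟩ := (nth_isStep_eq_iff (nextStepRun ρ) i _).1 rfl
    rw [nth_isStep_eq_iff]
    refine ⟨(hiff _).1 h1, ?_⟩
    rw [Nat.count_add, hk, Nat.count_nth_of_infinite (infinite_isStep ρ), ← hk, add_comm i 1]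
    congr 1
    convert h2 using 2
    exact funext fun j => propext (hiff j).symm
  rw [stepVar, stepVar, hnth, add_comm, nextStepRun, shiftRun_apply]

/-- The runs for which position `0` is a step and whose part after the next step belongs to
`B`. -/
def stepThen (B : Set (ℕ → Config Q Γ)) : Set (ℕ → Config Q Γ) :=
  {ρ | IsStep ρ 0 ∧ nextStepRun ρ ∈ B}

theorem measurableSet_stepThen {B : Set (ℕ → Config Q Γ)} (hB : MeasurableSet B) :
    MeasurableSet (stepThen B) :=
  (measurableSet_isStep 0).inter (measurable_nextStepRun hB)

theorem consRun_mem_stepThen_level {c : Config Q Γ} {ρ : ℕ → Config Q Γ}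
    (h : (ρ 0).stack = c.stack) (B : Set (ℕ → Config Q Γ)) :
    consRun c ρ ∈ stepThen B ↔ ρ ∈ B ∩ {ρ | IsStep ρ 0} := by
  have hiff : IsStep (consRun c ρ) 0 ↔ IsStep ρ 0 := by
    constructor
    · intro hs n _
      rw [h]
      exact hs (n + 1) (Nat.zero_le _)
    · intro hs n _
      cases n with
      | zero => exact le_rfl
      | succ n =>
        have := hs n (Nat.zero_le _)
        rwa [h] at this
  have hnext : IsStep ρ 0 → nextStepRun (consRun c ρ) = ρ := by
    intro hs
    have h1 : IsStep (consRun c ρ) (0 + 1) := (isStep_shiftRun_iff (consRun c ρ) 1 0).1 hs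
    rw [nextStepRun, nth_isStep_one_eq (hiff.2 hs) h1 (by simp), shiftRun_succ_consRun,
      shiftRun_zero]
  constructor
  · rintro ⟨h1, h2⟩
    rw [hnext (hiff.1 h1)] at h2
    exact ⟨h2, hiff.1 h1⟩
  · rintro ⟨h1, h2⟩
    refine ⟨hiff.2 h2, ?_⟩
    rwa [hnext h2]

end StepSequence

/-! ### First-transition analysis of the next step -/

namespace PVPA

open MarkovChain

variable {Q Γ : Type*} (Δ : PVPA Q Γ)

/-- The two alternatives are that the pushed `Z` stays forever, making the next position the next
step, or that it is popped at some time. In the second case no position in between is a step,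
because the run later drops to the height of `γ`. -/
theorem consRun_mem_stepThen_push {q : Q} {Z : Γ} {γ : List Γ} {ρ : ℕ → Config Q Γ}
    (hρ : ∀ n, Δ.next (ρ n) (ρ (n + 1)) ≠ 0) (h0 : (ρ 0).stack = Z :: γ)
    (B : Set (ℕ → Config Q Γ)) :
    consRun ⟨q, γ⟩ ρ ∈ stepThen B ↔ ρ ∈ B ∩ {ρ | IsStep ρ 0} ∨
      ∃ r k, ρ ∈ hitAt γ r k ∧ shiftRun k ρ ∈ B ∩ {ρ | IsStep ρ 0} := by
  have hup : IsStep ρ 0 → IsStep (consRun (⟨q, γ⟩ : Config Q Γ) ρ) 0 ∧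
      nextStepRun (consRun ⟨q, γ⟩ ρ) = ρ := by
    intro hs
    have hs0 : IsStep (consRun (⟨q, γ⟩ : Config Q Γ) ρ) 0 := by
      intro n _
      cases n with
      | zero => exact le_rfl
      | succ n =>
        have := hs n (Nat.zero_le _)
        rw [h0, List.length_cons] at this
        exact (Nat.le_succ _).trans this
    have h1 : IsStep (consRun (⟨q, γ⟩ : Config Q Γ) ρ) (0 + 1) :=
      (isStep_shiftRun_iff (consRun _ ρ) 1 0).1 hs
    refine ⟨hs0, ?_⟩
    rw [nextStepRun, nth_isStep_one_eq hs0 h1 (by simp), shiftRun_succ_consRun, shiftRun_zero]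
  have hback : ∀ {r k}, ρ ∈ hitAt γ r k → IsStep (shiftRun k ρ) 0 →
      IsStep (consRun (⟨q, γ⟩ : Config Q Γ) ρ) 0 ∧
        nextStepRun (consRun ⟨q, γ⟩ ρ) = shiftRun k ρ := by
    intro r k hk hs
    have hs' : IsStep ρ k := by simpa using (isStep_shiftRun_iff ρ k 0).1 hs
    have hs0 : IsStep (consRun (⟨q, γ⟩ : Config Q Γ) ρ) 0 := by
      intro n _
      cases n with
      | zero => exact le_rfl
      | succ n =>
        rcases lt_or_ge n k with hn | hn
        · exact (hk.2 n hn).le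
        · have := hs' n hn
          rwa [hk.1] at this
    have h1 : IsStep (consRun (⟨q, γ⟩ : Config Q Γ) ρ) (k + 1) :=
      (isStep_shiftRun_iff (consRun _ ρ) 1 k).1 hs'
    refine ⟨hs0, ?_⟩
    rw [nextStepRun, nth_isStep_one_eq hs0 h1, shiftRun_succ_consRun]
    intro j hj hs1
    have h2 := hs1 (k + 1) (by omega)
    simp only [consRun_succ, hk.1] at h2
    exact absurd (hk.2 j hj) (not_lt.2 h2)
  constructor
  · rintro ⟨h1, h2⟩
    by_cases hlow : ∃ k, (ρ k).stack.length ≤ γ.length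
    · obtain ⟨r, k, hk⟩ := Δ.exists_hitAt_of_valid (δ := [Z]) hρ h0 hlow
      have hs : IsStep (shiftRun k ρ) 0 := by
        intro n _
        simp only [shiftRun_apply, zero_add, hk.1]
        exact h1 (n + k + 1) (Nat.zero_le _)
      rw [(hback hk hs).2] at h2
      exact Or.inr ⟨r, k, hk, h2, hs⟩
    · have hs : IsStep ρ 0 := by
        intro n _
        rw [h0, List.length_cons]
        by_contra hn
        exact hlow ⟨n, by omega⟩
      rw [(hup hs).2] at h2
      exact Or.inl ⟨h2, hs⟩
  · rintro (⟨h1, h2⟩ | ⟨r, k, hk, h1, h2⟩)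
    · refine ⟨(hup h2).1, ?_⟩
      rwa [(hup h2).2]
    · refine ⟨(hback hk h2).1, ?_⟩
      rwa [(hback hk h2).2]

section Laws

variable [Fintype Q] [Fintype Γ]

theorem law_stepThen_int {q : Q} (h : Δ.kind q = .int) (γ : List Γ)
    {B : Set (ℕ → Config Q Γ)} (hB : MeasurableSet B) :
    law Δ.next ⟨q, γ⟩ (stepThen B) =
      ∑ r, Δ.Pint q h r * law Δ.next ⟨r, γ⟩ (B ∩ {ρ | IsStep ρ 0}) := by
  rw [law_apply _ _ (measurableSet_stepThen hB), next_int _ h, PMF.tsum_map_mul, tsum_fintype]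
  refine sum_congr rfl fun r _ => ?_
  congr 1
  refine measure_congr ?_
  filter_upwards [ae_zero_eq Δ.next ⟨r, γ⟩] with ρ h0
  exact propext (consRun_mem_stepThen_level (by rw [h0]) B)

theorem law_stepThen_ret_nil {q : Q} (h : Δ.kind q = .ret)
    {B : Set (ℕ → Config Q Γ)} (hB : MeasurableSet B) :
    law Δ.next ⟨q, []⟩ (stepThen B) =
      ∑ r, Δ.Pret q h ⊥ r * law Δ.next ⟨r, []⟩ (B ∩ {ρ | IsStep ρ 0}) := by
  rw [law_apply _ _ (measurableSet_stepThen hB), next_ret_nil _ h, PMF.tsum_map_mul, tsum_fintype]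
  refine sum_congr rfl fun r _ => ?_
  congr 1
  refine measure_congr ?_
  filter_upwards [ae_zero_eq Δ.next ⟨r, []⟩] with ρ h0
  exact propext (consRun_mem_stepThen_level (by rw [h0]) B)

theorem law_isStep_ret_cons {q : Q} (h : Δ.kind q = .ret) (Z : Γ) (γ : List Γ) :
    law Δ.next ⟨q, Z :: γ⟩ {ρ | IsStep ρ 0} = 0 := by
  refine measure_mono_null (t := {ρ | ¬ (ρ 0 = ⟨q, Z :: γ⟩ ∧ Δ.next (ρ 0) (ρ 1) ≠ 0)}) ?_ ?_
  · rintro ρ hs ⟨h0, h1⟩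
    have := hs 1 (Nat.zero_le _)
    rcases Δ.next_support h1 with ⟨hk, -⟩ | ⟨hk, -⟩ | ⟨-, ht⟩
    · rw [h0] at hk; exact absurd (h.symm.trans hk) (by simp)
    · rw [h0] at hk; exact absurd (h.symm.trans hk) (by simp)
    · rw [ht, h0] at this
      simp at this
  · rw [← ae_iff]
    filter_upwards [ae_zero_eq Δ.next ⟨q, Z :: γ⟩, ae_valid Δ.next ⟨q, Z :: γ⟩] with ρ h0 hv
    exact ⟨h0, hv 0⟩

theorem law_stepThen_call {q : Q} (h : Δ.kind q = .call) (γ : List Γ)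
    {B : Set (ℕ → Config Q Γ)} (hB : MeasurableSet B) :
    law Δ.next ⟨q, γ⟩ (stepThen B) =
      ∑ x, Δ.Pcall q h x * (law Δ.next ⟨x.1, x.2 :: γ⟩ (B ∩ {ρ | IsStep ρ 0}) +
        ∑ r, Δ.ret x.1 x.2 r * law Δ.next ⟨r, γ⟩ (B ∩ {ρ | IsStep ρ 0})) := by
  rw [law_apply _ _ (measurableSet_stepThen hB), next_call _ h, PMF.tsum_map_mul, tsum_fintype]
  refine sum_congr rfl fun x _ => ?_
  congr 1
  set B' := B ∩ {ρ : ℕ → Config Q Γ | IsStep ρ 0} with hB'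
  have hmB' : MeasurableSet B' := hB.inter (measurableSet_isStep 0)
  let H : Q → Set (ℕ → Config Q Γ) := fun r => {ρ | ∃ k, ρ ∈ hitAt γ r k ∧ shiftRun k ρ ∈ B'}
  have hH : ∀ r, MeasurableSet (H r) := by
    intro r
    have : H r = ⋃ k, (hitAt γ r k ∩ shiftRun k ⁻¹' B') := by
      ext; simp [H]
    rw [this]
    exact MeasurableSet.iUnion fun k => (measurableSet_hitAt γ r k).inter (measurable_shiftRun k hmB')
  have h1 : law Δ.next ⟨x.1, x.2 :: γ⟩ (consRun ⟨q, γ⟩ ⁻¹' stepThen B) =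
      law Δ.next ⟨x.1, x.2 :: γ⟩ (B' ∪ ⋃ r, H r) := by
    refine measure_congr ?_
    filter_upwards [ae_zero_eq Δ.next ⟨x.1, x.2 :: γ⟩, ae_valid Δ.next ⟨x.1, x.2 :: γ⟩] with ρ h0 hv
    refine propext ((Δ.consRun_mem_stepThen_push (Z := x.2) hv (by rw [h0]) B).trans ?_)
    change _ ↔ ρ ∈ B' ∪ ⋃ r, H r
    simp only [Set.mem_union, Set.mem_iUnion]
    rfl
  rw [h1, measure_union₀ (MeasurableSet.iUnion hH).nullMeasurableSet, measure_iUnion _ hH,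
    tsum_fintype]
  · congr 1
    exact sum_congr rfl fun r _ => Δ.law_hit hmB' γ x.1 x.2 r
  -- Disjointness in `r` is exact; that of `B'` and the return events, treated below, holds only
  -- almost surely because it uses `ρ 0`.
  · intro r r' hne
    refine Set.disjoint_left.2 ?_
    rintro ρ ⟨k, h, -⟩ ⟨k', h', -⟩
    exact hne (hitAt_disjoint h h').2
  · refine measure_mono_null ?_ (ae_iff.1 (ae_zero_eq Δ.next ⟨x.1, x.2 :: γ⟩))
    rintro ρ ⟨⟨-, hs⟩, hρ⟩ h0
    obtain ⟨r, k, hk, -⟩ := Set.mem_iUnion.1 hρ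
    have := hs k (Nat.zero_le _)
    rw [hk.1, h0] at this
    simp at this

end Laws

end PVPA

/-! ### The table of next-step probabilities -/

/-- Extended states as a sum type. -/
def ExtState.equivSum (Q : Type*) : ExtState Q ≃ Q ⊕ Q where
  toFun
    | .plain q => .inl q
    | .bottom q => .inr q
  invFun := Sum.elim .plain .bottom
  left_inv v := by cases v <;> rfl
  right_inv v := by cases v <;> rfl

instance {Q : Type*} [Fintype Q] : Fintype (ExtState Q) :=
  Fintype.ofEquiv _ (ExtState.equivSum Q).symm

theorem ExtState.sum_eq {Q : Type*} [Fintype Q] (f : ExtState Q → ℝ≥0∞) :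
    ∑ v, f v = ∑ q, f (.plain q) + ∑ q, f (.bottom q) := by
  rw [← (ExtState.equivSum Q).symm.sum_comp, Fintype.sum_sum_type]
  rfl

/-- Used with `d = [q↑]`, which may vanish; then `e * x` is a summand in the expansion of `[q↑]` and
vanishes too. -/
theorem ENNReal.mul_div_mul_cancel_of_imp {d e x : ℝ≥0∞} (hd : d ≠ ∞) (h : d = 0 → e * x = 0) :
    d * (e / d * x) = e * x := by
  by_cases h0 : d = 0
  · rw [h h0, h0, zero_mul]
  · rw [← mul_assoc, ENNReal.mul_div_cancel h0 hd]

theorem stepThen_univ {Q Γ : Type*} :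
    stepThen (Q := Q) (Γ := Γ) Set.univ = {ρ | IsStep ρ 0} := by
  ext; simp [stepThen]

namespace PVPA

open MarkovChain

variable {Q Γ : Type*} (Δ : PVPA Q Γ) [Fintype Q]

theorem diverge_ne_top (q : Q) : Δ.diverge q ≠ ∞ :=
  ((Δ.diverge_le_one q).trans_lt ENNReal.one_lt_top).ne

variable [Fintype Γ]

theorem nextStep_plain_plain_call {q : Q} (h : Δ.kind q = .call) (r : Q) :
    Δ.nextStep (.plain q) (.plain r) = Δ.diverge r / Δ.diverge q *
      (∑ r', ∑ Z, Δ.Pcall q h (r', Z) * Δ.ret r' Z r + ∑ Z, Δ.Pcall q h (r, Z)) := by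
  simp only [nextStep]
  split <;> rename_i h' <;> first | rfl | exact absurd (h.symm.trans h') (by simp)

theorem nextStep_plain_plain_int {q : Q} (h : Δ.kind q = .int) (r : Q) :
    Δ.nextStep (.plain q) (.plain r) = Δ.diverge r / Δ.diverge q * Δ.Pint q h r := by
  simp only [nextStep]
  split <;> rename_i h' <;> first | rfl | exact absurd (h.symm.trans h') (by simp)

theorem nextStep_plain_plain_ret {q : Q} (h : Δ.kind q = .ret) (r : Q) :
    Δ.nextStep (.plain q) (.plain r) = 0 := by
  simp only [nextStep]
  split <;> rename_i h' <;> first | rfl | exact absurd (h.symm.trans h') (by simp)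

theorem nextStep_bottom_plain_call {q : Q} (h : Δ.kind q = .call) (r : Q) :
    Δ.nextStep (.bottom q) (.plain r) = ∑ Z, Δ.Pcall q h (r, Z) * Δ.diverge r := by
  simp only [nextStep]
  split <;> rename_i h' <;> first | rfl | exact absurd (h.symm.trans h') (by simp)

theorem nextStep_bottom_plain_of_ne {q : Q} (h : Δ.kind q ≠ .call) (r : Q) :
    Δ.nextStep (.bottom q) (.plain r) = 0 := by
  simp only [nextStep]
  split <;> rename_i h' <;> first | rfl | exact absurd h' h

theorem nextStep_bottom_bottom_call {q : Q} (h : Δ.kind q = .call) (r : Q) :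
    Δ.nextStep (.bottom q) (.bottom r) = ∑ r', ∑ Z, Δ.Pcall q h (r', Z) * Δ.ret r' Z r := by
  simp only [nextStep]
  split <;> rename_i h' <;> first | rfl | exact absurd (h.symm.trans h') (by simp)

theorem nextStep_bottom_bottom_int {q : Q} (h : Δ.kind q = .int) (r : Q) :
    Δ.nextStep (.bottom q) (.bottom r) = Δ.Pint q h r := by
  simp only [nextStep]
  split <;> rename_i h' <;> first | rfl | exact absurd (h.symm.trans h') (by simp)

theorem nextStep_bottom_bottom_ret {q : Q} (h : Δ.kind q = .ret) (r : Q) :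
    Δ.nextStep (.bottom q) (.bottom r) = Δ.Pret q h ⊥ r := by
  simp only [nextStep]
  split <;> rename_i h' <;> first | rfl | exact absurd (h.symm.trans h') (by simp)

theorem nextStep_plain_bottom (q r : Q) : Δ.nextStep (.plain q) (.bottom r) = 0 := rfl

theorem diverge_ret {q : Q} (h : Δ.kind q = .ret) : Δ.diverge q = 0 := by
  rcases isEmpty_or_nonempty Γ with hΓ | ⟨⟨Z⟩⟩
  · simp [diverge]
  · rw [← Δ.law_isStep_cons q Z [], Δ.law_isStep_ret_cons h]

theorem diverge_int {q : Q} (h : Δ.kind q = .int) :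
    Δ.diverge q = ∑ r, Δ.diverge r * Δ.Pint q h r := by
  rcases isEmpty_or_nonempty Γ with hΓ | ⟨⟨Z⟩⟩
  · simp [diverge]
  · rw [← Δ.law_isStep_cons q Z [], ← stepThen_univ, Δ.law_stepThen_int h _ MeasurableSet.univ]
    simp only [Set.univ_inter, law_isStep_cons]
    exact sum_congr rfl fun r _ => mul_comm _ _

theorem sum_Pcall_mul_ret {q : Q} (h : Δ.kind q = .call) (r : Q) :
    ∑ r', ∑ Z, Δ.Pcall q h (r', Z) * Δ.ret r' Z r =
      ∑ x, Δ.Pcall q h x * Δ.ret x.1 x.2 r :=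
  (Fintype.sum_prod_type fun x : Q × Γ => Δ.Pcall q h x * Δ.ret x.1 x.2 r).symm

theorem diverge_call {q : Q} (h : Δ.kind q = .call) :
    Δ.diverge q = ∑ r, Δ.diverge r *
      (∑ r', ∑ Z, Δ.Pcall q h (r', Z) * Δ.ret r' Z r + ∑ Z, Δ.Pcall q h (r, Z)) := by
  -- A call state has a symbol to push, so `Γ` is nonempty and no separate case is needed.
  obtain ⟨⟨-, Z⟩, -⟩ := (Δ.Pcall q h).support_nonempty
  rw [← Δ.law_isStep_cons q Z [], ← stepThen_univ, Δ.law_stepThen_call h _ MeasurableSet.univ]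
  simp only [Set.univ_inter, law_isStep_cons]
  simp only [sum_Pcall_mul_ret, mul_add, sum_add_distrib, mul_sum]
  rw [add_comm, sum_comm, Fintype.sum_prod_type fun x : Q × Γ => Δ.Pcall q h x * Δ.diverge x.1]
  congr 1
  · exact sum_congr rfl fun r _ => sum_congr rfl fun x _ => by ring
  · exact sum_congr rfl fun r _ => sum_congr rfl fun x _ => mul_comm _ _

/-- The probability that the current position is a step, given the extended state. -/
def stayProb : ExtState Q → ℝ≥0∞
  | .plain q => Δ.diverge q
  | .bottom _ => 1

theorem law_isStep (c : Config Q Γ) :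
    law Δ.next c {ρ | IsStep ρ 0} = Δ.stayProb c.toExt := by
  obtain ⟨q, _ | ⟨Z, γ⟩⟩ := c
  · exact Δ.law_isStep_nil q
  · exact Δ.law_isStep_cons q Z γ

-- Clearing the denominator `[q↑]` turns the table row into the first-transition expansion of
-- `law_stepThen_int`. The same purpose is served by the two variants below.
open Classical in
theorem stayProb_mul_nextStep_int {q : Q} (h : Δ.kind q = .int) (γ : List Γ) (v : ExtState Q) :
    Δ.stayProb (Config.toExt ⟨q, γ⟩) * Δ.nextStep (Config.toExt ⟨q, γ⟩) v =
      ∑ r, Δ.Pint q h r * (if Config.toExt ⟨r, γ⟩ = v then Δ.stayProb v else 0) := by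
  cases γ with
  | nil =>
    cases v with
    | plain s =>
      simp [Config.toExt, stayProb, Δ.nextStep_bottom_plain_of_ne (q := q) (by simp [h])]
    | bottom s => simp [Config.toExt, stayProb, Δ.nextStep_bottom_bottom_int h]
  | cons Z γ =>
    cases v with
    | plain s =>
      simp only [Config.toExt, stayProb, Δ.nextStep_plain_plain_int h]
      rw [ENNReal.mul_div_mul_cancel_of_imp (Δ.diverge_ne_top q)]
      · simp [mul_comm]
      · intro h0
        rw [Δ.diverge_int h, sum_eq_zero_iff] at h0
        exact h0 s (mem_univ s)
    | bottom s => simp [Config.toExt, nextStep_plain_bottom]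

open Classical in
theorem stayProb_mul_nextStep_ret_nil {q : Q} (h : Δ.kind q = .ret) (v : ExtState Q) :
    Δ.stayProb (.bottom q) * Δ.nextStep (.bottom q) v =
      ∑ r, Δ.Pret q h ⊥ r * (if .bottom r = v then Δ.stayProb v else 0) := by
  cases v with
  | plain s => simp [Δ.nextStep_bottom_plain_of_ne (q := q) (by simp [h])]
  | bottom s => simp [stayProb, Δ.nextStep_bottom_bottom_ret h]

open Classical in
theorem stayProb_mul_nextStep_call {q : Q} (h : Δ.kind q = .call) (γ : List Γ)
    (v : ExtState Q) :
    Δ.stayProb (Config.toExt ⟨q, γ⟩) * Δ.nextStep (Config.toExt ⟨q, γ⟩) v =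
      ∑ x, Δ.Pcall q h x * ((if .plain x.1 = v then Δ.stayProb v else 0) +
        ∑ r, Δ.ret x.1 x.2 r * (if Config.toExt ⟨r, γ⟩ = v then Δ.stayProb v else 0)) := by
  have hplain : ∀ s, ∑ x : Q × Γ, Δ.Pcall q h x * (if x.1 = s then Δ.diverge s else 0) =
      ∑ Z, Δ.Pcall q h (s, Z) * Δ.diverge s := by
    intro s
    rw [Fintype.sum_prod_type, sum_eq_single s]
    · simp
    · intro b _ hb
      simp [hb]
    · simp
  cases γ with
  | nil =>
    cases v with
    | plain s =>
      simp [Config.toExt, stayProb, Δ.nextStep_bottom_plain_call h, ← hplain s]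
    | bottom s =>
      simp [Config.toExt, stayProb, Δ.nextStep_bottom_bottom_call h, ← Fintype.sum_prod_type']
  | cons Z γ =>
    cases v with
    | plain s =>
      simp only [Config.toExt, stayProb, Δ.nextStep_plain_plain_call h]
      rw [ENNReal.mul_div_mul_cancel_of_imp (Δ.diverge_ne_top q)]
      · simp only [ExtState.plain.injEq, mul_ite, mul_zero, sum_ite_eq', mem_univ, if_true, mul_add,
          sum_add_distrib]
        have := hplain s
        simp only [mul_ite, mul_zero] at this
        rw [this, add_comm, ← Fintype.sum_prod_type', mul_sum, mul_sum]
        congr 1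
        · exact sum_congr rfl fun Z _ => mul_comm _ _
        · exact sum_congr rfl fun x _ => by ring
      · intro h0
        rw [Δ.diverge_call h, sum_eq_zero_iff] at h0
        exact h0 s (mem_univ s)
    | bottom s => simp [Config.toExt, nextStep_plain_bottom]

/-! ### The step chain -/

/-- An extended state outside the step chain is some `plain r` with `[r↑] = 0` (automatic for return
states), and every entry of its column carries the factor `[r↑]` or is zero. -/
theorem nextStep_eq_zero_of_notMem (v : ExtState Q) {v' : ExtState Q} (hv' : v' ∉ Δ.stepStates) :
    Δ.nextStep v v' = 0 := by
  cases v' with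
  | bottom r => exact absurd (Or.inr ⟨r, rfl⟩) hv'
  | plain r =>
    have hr : Δ.diverge r = 0 := by
      by_contra h0
      cases hk : Δ.kind r with
      | ret => exact h0 (Δ.diverge_ret hk)
      | call => exact hv' (Or.inl ⟨r, rfl, Or.inl hk, pos_iff_ne_zero.2 h0⟩)
      | int => exact hv' (Or.inl ⟨r, rfl, Or.inr hk, pos_iff_ne_zero.2 h0⟩)
    cases v with
    | plain q =>
      cases hk : Δ.kind q with
      | call => simp [Δ.nextStep_plain_plain_call hk, hr]
      | int => simp [Δ.nextStep_plain_plain_int hk, hr]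
      | ret => exact Δ.nextStep_plain_plain_ret hk r
    | bottom q =>
      cases hk : Δ.kind q with
      | call => simp [Δ.nextStep_bottom_plain_call hk, hr]
      | int => exact Δ.nextStep_bottom_plain_of_ne (by simp [hk]) r
      | ret => exact Δ.nextStep_bottom_plain_of_ne (by simp [hk]) r

theorem sum_nextStep {v : ExtState Q} (hv : v ∈ Δ.stepStates) : ∑ v', Δ.nextStep v v' = 1 := by
  rw [ExtState.sum_eq]
  rcases hv with ⟨q, rfl, hk, hq⟩ | ⟨q, rfl⟩
  · simp only [nextStep_plain_bottom, sum_const_zero, add_zero]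
    rcases hk with hk | hk
    · simp only [Δ.nextStep_plain_plain_call hk, div_eq_mul_inv, mul_right_comm _ (Δ.diverge q)⁻¹]
      rw [← sum_mul, ← Δ.diverge_call hk, ENNReal.mul_inv_cancel hq.ne' (Δ.diverge_ne_top q)]
    · simp only [Δ.nextStep_plain_plain_int hk, div_eq_mul_inv, mul_right_comm _ (Δ.diverge q)⁻¹]
      rw [← sum_mul, ← Δ.diverge_int hk, ENNReal.mul_inv_cancel hq.ne' (Δ.diverge_ne_top q)]
  · cases hk : Δ.kind q with
    | call =>
      simp only [Δ.nextStep_bottom_plain_call hk, Δ.nextStep_bottom_bottom_call hk,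
        sum_Pcall_mul_ret]
      rw [← Fintype.sum_prod_type fun x : Q × Γ => Δ.Pcall q hk x * Δ.diverge x.1, sum_comm,
        ← sum_add_distrib]
      calc _ = ∑ x : Q × Γ, Δ.Pcall q hk x * (Δ.diverge x.1 + ∑ t, Δ.ret x.1 x.2 t) :=
            sum_congr rfl fun x _ => by rw [mul_add, mul_sum]
        _ = 1 := by
            simp only [diverge_add_sum_ret, mul_one]
            rw [← tsum_fintype (L := .unconditional _), PMF.tsum_coe]
    | int =>
      simp only [Δ.nextStep_bottom_plain_of_ne (q := q) (by simp [hk]),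
        Δ.nextStep_bottom_bottom_int hk, sum_const_zero, zero_add]
      rw [← tsum_fintype (L := .unconditional _), PMF.tsum_coe]
    | ret =>
      simp only [Δ.nextStep_bottom_plain_of_ne (q := q) (by simp [hk]),
        Δ.nextStep_bottom_bottom_ret hk, sum_const_zero, zero_add]
      rw [← tsum_fintype (L := .unconditional _), PMF.tsum_coe]

theorem tsum_nextStep (v : Δ.stepStates) : ∑' v' : Δ.stepStates, Δ.nextStep v v' = 1 := by
  rw [tsum_subtype_eq_of_support_subset, tsum_fintype, Δ.sum_nextStep v.2]
  intro v' hv'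
  by_contra hn
  exact hv' (Δ.nextStep_eq_zero_of_notMem v hn)

end PVPA

/-! ### Law of the footprint -/

theorem measurableSet_stepVar_cylinder {Q Γ : Type*} (w : ℕ → ExtState Q) (n : ℕ) :
    MeasurableSet {ρ : ℕ → Config Q Γ | ∀ i ≤ n, stepVar i ρ = w i} := by
  have : {ρ : ℕ → Config Q Γ | ∀ i ≤ n, stepVar i ρ = w i} =
      ⋂ i, ⋂ (_ : i ≤ n), stepVar i ⁻¹' {w i} := by
    ext; simp
  rw [this]
  exact MeasurableSet.iInter fun i => MeasurableSet.iInter fun _ =>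
    measurable_stepVar i (measurableSet_singleton _)

namespace PVPA

open MarkovChain

variable {Q Γ : Type*} (Δ : PVPA Q Γ) [Fintype Q]

/-- Decomposition of an event along the first `n` steps. -/
theorem prob_eq_sum_prefix (n : ℕ) (E : Set (ℕ → Config Q Γ)) :
    Δ.prob E = ∑ p : Fin n → ExtState Q, Δ.prob (E ∩ {ρ | ∀ i : Fin n, stepVar i ρ = p i}) := by
  have hf : Measurable fun (ρ : ℕ → Config Q Γ) (i : Fin n) => stepVar (i : ℕ) ρ :=
    measurable_pi_iff.2 fun i => measurable_stepVar i
  -- Restricting the measure to `E` means that only the prefix map, and not `E`, has to be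
  -- measurable.
  have h := sum_measure_preimage_singleton (μ := Δ.prob.restrict E) univ
    (f := fun (ρ : ℕ → Config Q Γ) (i : Fin n) => stepVar (i : ℕ) ρ)
    fun p _ => hf (measurableSet_singleton p)
  rw [coe_univ, Set.preimage_univ, Measure.restrict_apply_univ] at h
  rw [← h]
  refine sum_congr rfl fun p _ => ?_
  rw [Measure.restrict_apply (hf (measurableSet_singleton p)), Set.inter_comm]
  congr 2
  ext ρ
  simp [funext_iff]

open Classical in
/-- The footprint of a run as a run of the step chain (with a default value for the extended
states outside of the step chain). -/
def chainFootprint (ρ : ℕ → Config Q Γ) : ℕ → Δ.stepStates := fun n =>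
  if h : stepVar n ρ ∈ Δ.stepStates then ⟨stepVar n ρ, h⟩ else ⟨.bottom Δ.init, .inr ⟨Δ.init, rfl⟩⟩

theorem measurable_chainFootprint : Measurable Δ.chainFootprint := by
  classical
  refine measurable_pi_iff.2 fun n => ?_
  exact (Measurable.of_discrete (f := fun v : ExtState Q => if h : v ∈ Δ.stepStates then
    (⟨v, h⟩ : Δ.stepStates) else ⟨.bottom Δ.init, .inr ⟨Δ.init, rfl⟩⟩)).comp (measurable_stepVar n)

theorem coe_chainFootprint {ρ : ℕ → Config Q Γ} {n : ℕ} (h : stepVar n ρ ∈ Δ.stepStates) :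
    (Δ.chainFootprint ρ n : ExtState Q) = stepVar n ρ := by
  simp [chainFootprint, h]

theorem setOf_footprint_eq (R : Set (ℕ → Δ.stepStates)) :
    {ρ : ℕ → Config Q Γ | ∃ w ∈ R, footprint ρ = fun n => (w n : ExtState Q)} =
      (⋂ n, stepVar n ⁻¹' Δ.stepStates) ∩ Δ.chainFootprint ⁻¹' R := by
  ext ρ
  simp only [Set.mem_ofPred_eq, Set.mem_inter_iff, Set.mem_iInter, Set.mem_preimage]
  constructor
  · rintro ⟨w, hw, hρ⟩
    have hn : ∀ n, stepVar n ρ = w n := fun n => congrFun hρ n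
    have hmem : ∀ n, stepVar n ρ ∈ Δ.stepStates := fun n => by rw [hn]; exact (w n).2
    refine ⟨hmem, ?_⟩
    have : Δ.chainFootprint ρ = w :=
      funext fun n => Subtype.ext ((Δ.coe_chainFootprint (hmem n)).trans (hn n))
    rwa [this]
  · rintro ⟨h1, h2⟩
    exact ⟨_, h2, funext fun n => (Δ.coe_chainFootprint (h1 n)).symm⟩

instance : IsProbabilityMeasure Δ.prob := by
  unfold prob; infer_instance

variable [Fintype Γ]

open Classical in
/-- The joint law of the first steps of a run, restricted to the event that the initial position
is a step. -/
theorem law_stepVar_cylinder (n : ℕ) (c : Config Q Γ) (w : ℕ → ExtState Q) :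
    law Δ.next c ({ρ | ∀ i ≤ n, stepVar i ρ = w i} ∩ {ρ | IsStep ρ 0}) =
      if c.toExt = w 0 then
        Δ.stayProb (w 0) * ∏ i ∈ range n, Δ.nextStep (w i) (w (i + 1)) else 0 := by
  by_cases hc : c.toExt = w 0
  swap
  · rw [if_neg hc]
    refine measure_mono_null ?_ (ae_iff.1 (ae_zero_eq Δ.next c))
    rintro ρ ⟨h1, h2⟩ h0
    have := h1 0 (Nat.zero_le _)
    rw [stepVar_zero h2, h0] at this
    exact hc this
  rw [if_pos hc]
  induction n generalizing c w with
  | zero =>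
    rw [range_zero, prod_empty, mul_one, ← hc, ← law_isStep]
    refine measure_congr ?_
    filter_upwards [ae_zero_eq Δ.next c] with ρ h0
    refine propext ⟨fun h => h.2, fun h => ⟨fun i hi => ?_, h⟩⟩
    obtain rfl : i = 0 := by omega
    rw [stepVar_zero h, h0, hc]
  | succ n ih =>
    set B : Set (ℕ → Config Q Γ) := {ρ | ∀ i ≤ n, stepVar i ρ = w (i + 1)} with hB
    have hBm : MeasurableSet B := measurableSet_stepVar_cylinder (fun i => w (i + 1)) n
    set p := ∏ i ∈ range n, Δ.nextStep (w (i + 1)) (w (i + 2)) with hp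
    have ih' : ∀ c' : Config Q Γ, law Δ.next c' (B ∩ {ρ | IsStep ρ 0}) =
        (if c'.toExt = w 1 then Δ.stayProb (w 1) else 0) * p := by
      intro c'
      by_cases hc' : c'.toExt = w 1
      · rw [if_pos hc']
        exact ih c' (fun i => w (i + 1)) hc'
      · rw [if_neg hc', zero_mul]
        refine measure_mono_null ?_ (ae_iff.1 (ae_zero_eq Δ.next c'))
        rintro ρ ⟨h1, h2⟩ h0
        have := h1 0 (Nat.zero_le _)
        rw [stepVar_zero h2, h0] at this
        exact hc' this
    have hset : law Δ.next c ({ρ | ∀ i ≤ n + 1, stepVar i ρ = w i} ∩ {ρ | IsStep ρ 0}) =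
        law Δ.next c (stepThen B) := by
      refine measure_congr ?_
      filter_upwards [ae_zero_eq Δ.next c] with ρ h0
      refine propext ⟨?_, ?_⟩
      · rintro ⟨h1, h2⟩
        refine ⟨h2, fun i hi => ?_⟩
        rw [← stepVar_succ]
        exact h1 (i + 1) (by omega)
      · rintro ⟨h1, h2⟩
        refine ⟨fun i hi => ?_, h1⟩
        cases i with
        | zero => rw [stepVar_zero h1, h0, hc]
        | succ i =>
          rw [stepVar_succ]
          exact h2 i (by omega)
    rw [hset, prod_range_succ', ← hp, mul_comm p, ← mul_assoc, ← hc, zero_add]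
    obtain ⟨q, γ⟩ := c
    cases hk : Δ.kind q with
    | call =>
      rw [law_stepThen_call _ hk γ hBm, stayProb_mul_nextStep_call _ hk, sum_mul]
      refine sum_congr rfl fun x _ => ?_
      simp only [ih', mul_assoc, add_mul, sum_mul]
      rfl
    | int =>
      rw [law_stepThen_int _ hk γ hBm, stayProb_mul_nextStep_int _ hk, sum_mul]
      refine sum_congr rfl fun r _ => ?_
      rw [ih', mul_assoc]
    | ret =>
      cases γ with
      | nil =>
        rw [law_stepThen_ret_nil _ hk hBm]
        refine Eq.trans ?_ (congrArg (· * p) (Δ.stayProb_mul_nextStep_ret_nil hk (w 1)).symm)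
        simp only [sum_mul]
        refine sum_congr rfl fun r _ => ?_
        rw [ih', mul_assoc]
        rfl
      | cons Z γ =>
        have h0 : Δ.stayProb (Config.toExt ⟨q, Z :: γ⟩) = 0 := Δ.diverge_ret hk
        rw [h0, zero_mul, zero_mul]
        exact measure_mono_null (fun ρ hρ => hρ.1) (Δ.law_isStep_ret_cons hk Z γ)

open Classical in
/-- The joint law of the first steps of a run of the automaton. -/
theorem prob_stepVar_cylinder (n : ℕ) (w : ℕ → ExtState Q) :
    Δ.prob {ρ | ∀ i ≤ n, stepVar i ρ = w i} =
      if w 0 = .bottom Δ.init then ∏ i ∈ range n, Δ.nextStep (w i) (w (i + 1)) else 0 := by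
  have hprob : Δ.prob = law Δ.next ⟨Δ.init, []⟩ := rfl
  have h1 := Δ.law_stepVar_cylinder n ⟨Δ.init, []⟩ w
  have h2 : law Δ.next ⟨Δ.init, []⟩ ({ρ | ∀ i ≤ n, stepVar i ρ = w i} ∩ {ρ | IsStep ρ 0}) =
      law Δ.next ⟨Δ.init, []⟩ {ρ | ∀ i ≤ n, stepVar i ρ = w i} := by
    refine measure_congr ?_
    filter_upwards [ae_zero_eq Δ.next ⟨Δ.init, []⟩] with ρ h0
    refine propext ⟨fun h => h.1, fun h => ⟨h, fun n _ => ?_⟩⟩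
    simp [h0]
  rw [hprob, ← h2, h1]
  by_cases h : w 0 = .bottom Δ.init
  · rw [if_pos h, if_pos (by rw [h]; rfl), h]
    simp [stayProb]
  · rw [if_neg h, if_neg fun h' => h (h'.symm.trans rfl)]

theorem prob_stepVar_cylinder_succ (n : ℕ) (w : ℕ → ExtState Q) :
    Δ.prob {ρ | ∀ i ≤ n + 1, stepVar i ρ = w i} =
      Δ.prob {ρ | ∀ i ≤ n, stepVar i ρ = w i} * Δ.nextStep (w n) (w (n + 1)) := by
  classical
  rw [prob_stepVar_cylinder, prob_stepVar_cylinder, prod_range_succ, ite_mul, zero_mul]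

/-- Summing over all prefixes of length `n`, each cylinder gains the same last factor. In product
form, this also covers `v` of probability zero. -/
theorem prob_stepVar_inter (n : ℕ) (v v' : ExtState Q) :
    Δ.prob ({ρ | stepVar n ρ = v} ∩ {ρ | stepVar (n + 1) ρ = v'}) =
      Δ.prob {ρ | stepVar n ρ = v} * Δ.nextStep v v' := by
  rw [Δ.prob_eq_sum_prefix n, Δ.prob_eq_sum_prefix n {ρ | stepVar n ρ = v}, sum_mul]
  refine sum_congr rfl fun p _ => ?_
  let w : ℕ → ExtState Q := fun i => if h : i < n then p ⟨i, h⟩ else if i = n then v else v'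
  have hwn : w n = v := by simp [w]
  have hwn1 : w (n + 1) = v' := by simp [w]
  have hw : ∀ i : Fin n, w i = p i := fun i => by simp [w]
  have h1 : {ρ : ℕ → Config Q Γ | stepVar n ρ = v} ∩ {ρ | ∀ i : Fin n, stepVar i ρ = p i} =
      {ρ | ∀ i ≤ n, stepVar i ρ = w i} := by
    ext ρ
    constructor
    · rintro ⟨h1, h2⟩ i hi
      rcases hi.lt_or_eq with hi | rfl
      · exact (h2 ⟨i, hi⟩).trans (hw ⟨i, hi⟩).symm
      · exact h1.trans hwn.symm
    · intro h
      exact ⟨(h n le_rfl).trans hwn, fun i => (h i i.2.le).trans (hw i)⟩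
  have h2 : {ρ : ℕ → Config Q Γ | stepVar n ρ = v} ∩ {ρ | stepVar (n + 1) ρ = v'} ∩
      {ρ | ∀ i : Fin n, stepVar i ρ = p i} = {ρ | ∀ i ≤ n + 1, stepVar i ρ = w i} := by
    rw [Set.inter_right_comm, h1]
    ext ρ
    constructor
    · rintro ⟨h1, h2⟩ i hi
      rcases hi.lt_or_eq with hi | rfl
      · exact h1 i (by omega)
      · exact h2.trans hwn1.symm
    · intro h
      exact ⟨fun i hi => h i (by omega), (h (n + 1) le_rfl).trans hwn1⟩
  rw [h1, h2, prob_stepVar_cylinder_succ, hwn, hwn1]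

/-- Almost surely, all steps of a run are states of the step chain. -/
theorem prob_stepVar_eq_zero (n : ℕ) {v : ExtState Q} (hv : v ∉ Δ.stepStates) :
    Δ.prob {ρ | stepVar n ρ = v} = 0 := by
  classical
  cases n with
  | zero =>
    have h := Δ.prob_stepVar_cylinder 0 (fun _ => v)
    rw [if_neg fun h => hv (Or.inr ⟨_, h⟩)] at h
    simpa using h
  | succ n =>
    have : {ρ : ℕ → Config Q Γ | stepVar (n + 1) ρ = v} =
        ⋃ u, {ρ | stepVar n ρ = u} ∩ {ρ | stepVar (n + 1) ρ = v} := by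
      ext ρ; simp
    rw [this, measure_iUnion_null_iff]
    intro u
    rw [prob_stepVar_inter, Δ.nextStep_eq_zero_of_notMem u hv, mul_zero]

theorem ae_stepVar_mem : ∀ᵐ ρ ∂Δ.prob, ∀ n, stepVar n ρ ∈ Δ.stepStates := by
  rw [ae_all_iff]
  intro n
  have : ∀ᵐ ρ ∂Δ.prob, ∀ v, v ∉ Δ.stepStates → stepVar n ρ ≠ v := by
    rw [ae_all_iff]
    intro v
    by_cases hv : v ∈ Δ.stepStates
    · simp [hv]
    · simpa [ae_iff, hv] using Δ.prob_stepVar_eq_zero n hv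
  filter_upwards [this] with ρ hρ
  by_contra hn
  exact hρ _ hn rfl

/-- The law of the footprint is the law of the step chain. -/
theorem map_chainFootprint (h : ∀ v : Δ.stepStates, ∑' v' : Δ.stepStates, Δ.nextStep v v' = 1) :
    Δ.prob.map Δ.chainFootprint = (Δ.stepChain h).measure := by
  classical
  refine ext_of_cylinder fun w n => ?_
  rw [Measure.map_apply Δ.measurable_chainFootprint (measurableSet_cylinder w n),
    measure_cylinder]
  have h1 : Δ.prob (Δ.chainFootprint ⁻¹' {ρ | ∀ i ≤ n, ρ i = w i}) =
      Δ.prob {ρ | ∀ i ≤ n, stepVar i ρ = w i} := by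
    refine measure_congr ?_
    filter_upwards [Δ.ae_stepVar_mem] with ρ hρ
    refine propext ?_
    change (∀ i ≤ n, Δ.chainFootprint ρ i = w i) ↔ ∀ i ≤ n, stepVar i ρ = w i
    simp only [Subtype.ext_iff, Δ.coe_chainFootprint (hρ _)]
  rw [h1, Δ.prob_stepVar_cylinder n (fun i => w i)]
  refine if_congr ?_ rfl rfl
  exact ⟨fun h0 => Subtype.ext h0, fun h0 => congrArg Subtype.val h0⟩

end PVPA

end

theorem lemma4p6 {Q Γ : Type*} [Fintype Q] [Fintype Γ] (Δ : PVPA Q Γ) :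
    -- the diverge probabilities are well-defined
    (∀ q Z, Δ.diverge q = 1 - ∑ t, Δ.ret q Z t) ∧
    -- the states at the steps are random variables
    (∀ n, Measurable (stepVar (Q := Q) (Γ := Γ) n)) ∧
    -- whenever a conditional next-step probability is defined, the table gives its value
    (∀ n v v', Δ.prob {ρ | stepVar n ρ = v} ≠ 0 →
      (Δ.prob[|{ρ | stepVar n ρ = v}]) {ρ | stepVar (n + 1) ρ = v'} = Δ.nextStep v v') ∧
    -- the undefined entries of the table never occur
    (∀ n q, Δ.kind q = .ret → Δ.prob {ρ | stepVar n ρ = .plain q} = 0) ∧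
    -- the step chain is a Markov chain, and it is sound
    ∃ h : ∀ v : Δ.stepStates, ∑' v' : Δ.stepStates, Δ.nextStep v v' = 1,
      ∀ R : Set (ℕ → Δ.stepStates), MeasurableSet R →
        MeasurableSet {ρ : ℕ → Config Q Γ | ∃ w ∈ R, footprint ρ = fun n => (w n : ExtState Q)} ∧
        Δ.prob {ρ | ∃ w ∈ R, footprint ρ = fun n => (w n : ExtState Q)} =
          (Δ.stepChain h).measure R := by
  refine ⟨Δ.diverge_eq, measurable_stepVar, ?_, ?_, Δ.tsum_nextStep, ?_⟩
  · intro n v v' hv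
    have hm : MeasurableSet {ρ : ℕ → Config Q Γ | stepVar n ρ = v} :=
      measurable_stepVar n (measurableSet_singleton v)
    rw [cond_apply hm, Δ.prob_stepVar_inter, ← mul_assoc,
      ENNReal.inv_mul_cancel hv (measure_ne_top _ _), one_mul]
  · intro n q hq
    refine Δ.prob_stepVar_eq_zero n ?_
    rintro (⟨r, hr, hk, -⟩ | ⟨r, hr⟩)
    · obtain rfl : q = r := ExtState.plain.inj hr
      simp [hq] at hk
    · cases hr
  · intro R hR
    rw [Δ.setOf_footprint_eq R]
    have hm := Δ.measurable_chainFootprint hR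
    refine ⟨(MeasurableSet.iInter fun n => measurable_stepVar n MeasurableSet.of_discrete).inter hm,
      ?_⟩
    rw [← Δ.map_chainFootprint Δ.tsum_nextStep,
      Measure.map_apply Δ.measurable_chainFootprint hR]
    refine measure_congr ?_
    filter_upwards [Δ.ae_stepVar_mem] with ρ hρ
    -- Almost surely every step lies in `stepStates`, so the default value in `chainFootprint` is
    -- never used.
    exact propext ⟨fun h => h.2, fun h => ⟨Set.mem_iInter.2 hρ, h⟩⟩
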